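/- Conventions. Manifolds are finite-dimensional, Hausdorff, second countable and smooth; "open" and "local" in a diffeological space refer to the D-topology; subsets carry the subset diffeology and products the product diffeology. A smooth map $p\colon X\to Y$ of diffeological spaces is a *local subduction* if for every plot $\phi\colon U\to Y$, $a\in U$ and $x\in X$ with $\phi(a)=p(x)$ there are an open neighborhood $V\subset U$ of $a$ and a plot $\psi\colon V\to X$ with $\psi(a)=x$ and $p\circ\psi=\phi|_V$. A map $\pi\colon X\to Y$ is *quasi-étale* if it is a local subduction, its fibers are totally disconnected (all plots of a fiber are locally constant), and every smooth map $f\colon\mathcal O\to X$ with $\mathcal O\subset X$ open and $\pi\circ f=\pi|_{\mathcal O}$ is a local diffeomorphism. A diffeological space $X$ is *quasi-étale* if every point of $X$ lies in the image of a quasi-étale map from a manifold to $X$; $\mathbf{QUED}$ is the category of such spaces and smooth maps. A morphism $p\colon X\to Z$ of $\mathbf{QUED}$ is a *$\mathbf{QUED}$-submersion* if it is a local subduction and, for each morphism $f\colon Y\to Z$ of $\mathbf{QUED}$, either the fiber product of $p$ and $f$ exists in $\mathbf{QUED}$ or there is no commutative square on $p$ and $f$. A *local $\mathbf{QUED}$-groupoid*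 $\mathcal G\rightrightarrows M$ consists of quasi-étale spaces $\mathcal G$ and $M$, $\mathbf{QUED}$-submersions $s,t\colon\mathcal G\to M$, a smooth unit map $u\colon M\to\mathcal G$, a smooth multiplication $m\colon\mathcal M\to\mathcal G$, $(g,h)\mapsto gh$, on an open subset $\mathcal M\subset\mathcal G\times_{s,t}\mathcal G$ containing $(u(x),u(x))$ for all $x\in M$, and a smooth inverse map $i\colon\mathcal I\to\mathcal G$ on an open neighborhood $\mathcal I\subset\mathcal G$ of $u(M)$, such that $s\circ u=t\circ u=\mathrm{id}_M$; $s(gh)=s(h)$ and $t(gh)=t(g)$ on $\mathcal M$; $s(i(g))=t(g)$ on $\mathcal I$; and $u(t(g))\,g=g=g\,u(s(g))$, $g\,i(g)=u(t(g))$, $i(g)\,g=u(s(g))$, $g(hk)=(gh)k$ whenever the expressions involved are defined. It is a *local singular Lie groupoid* if $M$ is a manifold, and a *local Lie groupoid* if $\mathcal G$ and $M$ are manifolds. A *morphism* $\mathcal G\to\mathcal H$ of local $\mathbf{QUED}$-groupoids $\mathcal G\rightrightarrows M$, $\mathcal H\rightrightarrows N$ covering a smooth map $f\colon M\to N$ is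 a germ $[\mathcal F]$ along $u(M)$ of maps from $\mathcal G$ to $\mathcal H$ which has a representative $\mathcal F$, smooth on an open neighborhood of $u(M)$, that maps $u(M)$ into $u(N)$ and satisfies $s(\mathcal F(g))=f(s(g))$, $t(\mathcal F(g))=f(t(g))$ and $\mathcal F(gh)=\mathcal F(g)\mathcal F(h)$ on that neighborhood whenever the expressions involved are defined. A *local Lie groupoid chart* of a local singular Lie groupoid $\mathcal G\rightrightarrows M$ consists of an open subset $\widetilde M\subset M$, a local Lie groupoid $\widetilde{\mathcal G}\rightrightarrows\widetilde M$ and a quasi-étale map $\pi\colon\widetilde{\mathcal G}\to\mathcal G$ whose germ $[\pi]$ along the units is a morphism of local groupoids covering the inclusion $\widetilde M\hookrightarrow M$. It is *wide* if $\widetilde M=M$. **Theorem.** Let $\mathcal G\rightrightarrows M$ and $\mathcal H\rightrightarrows N$ be local singular Lie groupoids, let $[\mathcal F]\colon\mathcal G\to\mathcal H$ be a morphism of local groupoids, and let $\pi_{\mathcal G}\colon\widetilde{\mathcal G}\to\mathcal G$ and $\pi_{\mathcal H}\colon\widetilde{\mathcal H}\to\mathcal H$ be wide local Lie groupoid charts.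 Then there exists a unique morphism of local groupoids $[\widetilde{\mathcal F}]\colon\widetilde{\mathcal G}\to\widetilde{\mathcal H}$ such that $$[\pi_{\mathcal H}]\circ[\widetilde{\mathcal F}]=[\mathcal F]\circ[\pi_{\mathcal G}]$$ as germs along the units of $\widetilde{\mathcal G}$. -/

import Mathlib

universe u v

namespace SingLie

open Diffeology

/-! ### Subset and product diffeologies -/

/-- The pullback of a diffeology along a function: `p` is a plot iff `f ∘ p` is a plot. -/
@[reducible]
def inducedDiffeology {X : Type*} {Y : Type*} [DiffeologicalSpace Y] (f : X → Y) :
    DiffeologicalSpace X where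
  plots n := {p | IsPlot (f ∘ p)}
  constant_plots x := isPlot_const (x := f x)
  plot_reparam hp hf := isPlot_reparam hp hf
  locality {n p} hp := DiffeologicalSpace.locality (p := f ∘ p) fun x => by
    obtain ⟨w, hw, hx, h⟩ := hp x
    exact ⟨w, hw, hx, fun hm hs => h hm hs⟩

/-- The subset diffeology. -/
instance subsetDiffeology {X : Type*} [DiffeologicalSpace X] {P : X → Prop} :
    DiffeologicalSpace (Subtype P) :=
  inducedDiffeology Subtype.val

/-- The product diffeology. -/
instance productDiffeology {X : Type*} {Y : Type*} [DiffeologicalSpace X]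
    [DiffeologicalSpace Y] : DiffeologicalSpace (X × Y) where
  plots n := {p | IsPlot (fun a => (p a).1) ∧ IsPlot (fun a => (p a).2)}
  constant_plots x := ⟨isPlot_const, isPlot_const⟩
  plot_reparam hp hf := ⟨isPlot_reparam hp.1 hf, isPlot_reparam hp.2 hf⟩
  locality {n p} hp := by
    constructor
    · refine DiffeologicalSpace.locality fun x => ?_
      obtain ⟨w, hw, hx, h⟩ := hp x
      exact ⟨w, hw, hx, fun hm hs => (h hm hs).1⟩
    · refine DiffeologicalSpace.locality fun x => ?_
      obtain ⟨w, hw, hx, h⟩ := hp x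
      exact ⟨w, hw, hx, fun hm hs => (h hm hs).2⟩

/-- A subset is open when it is open for the D-topology. -/
def DOpen {X : Type*} [DiffeologicalSpace X] (S : Set X) : Prop :=
  @IsOpen X DiffeologicalSpace.dTopology S

/-! ### Smooth maps and manifolds -/

/-- A bijection that is smooth together with its inverse. -/
def IsDiffeo {X : Type*} {Y : Type*} [DiffeologicalSpace X] [DiffeologicalSpace Y]
    (e : X ≃ Y) : Prop :=
  DSmooth e ∧ DSmooth e.symm

/-- Every point has an open neighborhood which `f` maps diffeomorphically onto an open set. -/
def IsLocalDiffeo {X : Type*} {Y : Type*} [DiffeologicalSpace X] [DiffeologicalSpace Y]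
    (f : X → Y) : Prop :=
  ∀ x : X, ∃ (U : Set X) (V : Set Y) (e : U ≃ V), DOpen U ∧ x ∈ U ∧ DOpen V ∧ IsDiffeo e ∧
    ∀ a : U, (e a : Y) = f a

/-- A (finite-dimensional, Hausdorff, second countable) smooth manifold, regarded as a
diffeological space: the D-topology is Hausdorff and second countable, and every point has an
open neighborhood diffeomorphic to an open subset of some `ℝⁿ`. Different components are allowed
to have different dimensions. -/
structure IsSmoothManifold (X : Type*) [DiffeologicalSpace X] : Prop where
  t2 : @T2Space X DiffeologicalSpace.dTopology
  secondCountable : @SecondCountableTopology X DiffeologicalSpace.dTopology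
  charts : ∀ x : X, ∃ (n : ℕ) (U : Set X) (V : Set (EuclideanSpace ℝ (Fin n))) (e : U ≃ V),
    DOpen U ∧ x ∈ U ∧ IsOpen V ∧ IsDiffeo e

/-- A smooth map `f` is a local subduction when every plot `φ : U → Y` (with `U ⊆ ℝⁿ` open)
lifts, near any `a ∈ U`, to a plot of `X` through any prescribed point `x` over `φ a`. -/
structure IsLocalSubduction {X : Type*} {Y : Type*} [DiffeologicalSpace X]
    [DiffeologicalSpace Y] (f : X → Y) : Prop where
  smooth : DSmooth f
  lift : ∀ (n : ℕ) (U : Set (EuclideanSpace ℝ (Fin n))), IsOpen U →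
    ∀ φ : U → Y, DSmooth φ → ∀ (a : U) (x : X), φ a = f x →
      ∃ (V : Set (EuclideanSpace ℝ (Fin n))) (hVU : V ⊆ U) (ha : a.1 ∈ V) (ψ : V → X),
        IsOpen V ∧ DSmooth ψ ∧ ψ ⟨a, ha⟩ = x ∧ ∀ b : V, f (ψ b) = φ ⟨b, hVU b.2⟩

/-- A subset is totally disconnected when all plots of its subset diffeology are locally
constant. -/
def IsTotDisconnected {X : Type*} [DiffeologicalSpace X] (S : Set X) : Prop :=
  ∀ (n : ℕ) (p : EuclideanSpace ℝ (Fin n) → S), IsPlot p → IsLocallyConstant p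

/-! ### Quasi-étale maps and spaces -/

/-- Quasi-étale maps. -/
structure IsQuasiEtale {X : Type*} {Y : Type*} [DiffeologicalSpace X] [DiffeologicalSpace Y]
    (π : X → Y) : Prop where
  localSubduction : IsLocalSubduction π
  fibers : ∀ y : Y, IsTotDisconnected (π ⁻¹' {y})
  rigid : ∀ (O : Set X) (f : O → X), DOpen O → DSmooth f → (∀ a : O, π (f a) = π a) →
    IsLocalDiffeo f

/-- Quasi-étale diffeological spaces: every point lies in the image of a quasi-étale map whose
domain is a smooth manifold. -/
def IsQUED (X : Type u) [DiffeologicalSpace X] : Prop :=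
  ∀ x : X, ∃ (P : Type u) (_ : DiffeologicalSpace P) (π : P → X),
    IsSmoothManifold P ∧ IsQuasiEtale π ∧ x ∈ Set.range π

/-- The objects of the category of quasi-étale diffeological spaces. -/
structure QUED : Type (u + 1) where
  carrier : Type u
  [diffeology : DiffeologicalSpace carrier]
  isQUED : IsQUED carrier

attribute [instance] QUED.diffeology

/-- The category of quasi-étale diffeological spaces and smooth maps. -/
instance : CategoryTheory.Category QUED.{u} where
  Hom X Y := {f : X.carrier → Y.carrier // DSmooth f}
  id X := ⟨id, dSmooth_id⟩
  comp f g := ⟨g.1 ∘ f.1, g.2.comp f.2⟩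

/-- A smooth map, as a morphism of the category `QUED`. -/
def QUED.ofSmooth {X Z : QUED.{u}} (p : X.carrier → Z.carrier) (hp : DSmooth p) : X ⟶ Z :=
  ⟨p, hp⟩

/-- A morphism `p : X ⟶ Z` is cartesian when for every `f : Y ⟶ Z`, either the fiber product of
`p` and `f` exists, or there is no commutative square on `p` and `f` at all. -/
def IsCartesianMorphism {C : Type v} [CategoryTheory.Category.{u} C] {X Z : C} (p : X ⟶ Z) :
    Prop :=
  ∀ (Y : C) (f : Y ⟶ Z), CategoryTheory.Limits.HasPullback p f ∨
    ∀ (W : C) (a : W ⟶ X) (b : W ⟶ Y),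
      CategoryTheory.CategoryStruct.comp a p ≠ CategoryTheory.CategoryStruct.comp b f

/-- Submersions of quasi-étale diffeological spaces: local subductions that are cartesian
morphisms of the category `QUED`. -/
structure IsQUEDSubmersion {X Z : Type u} [DiffeologicalSpace X] [DiffeologicalSpace Z]
    (p : X → Z) : Prop where
  domain : IsQUED X
  codomain : IsQUED Z
  localSubduction : IsLocalSubduction p
  cartesian : IsCartesianMorphism
    (QUED.ofSmooth (X := ⟨X, domain⟩) (Z := ⟨Z, codomain⟩) p localSubduction.smooth)

/-! ### Local groupoids -/

/-- The space of composable pairs, with the subset diffeology of the product diffeology. -/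
abbrev Composable {G X : Type u} (s t : G → X) : Type u := {p : G × G // s p.1 = t p.2}

/-- For a partially defined multiplication `m` with domain `D`, the statement that the product
`g h` is defined and equal to `k`. -/
def IsProd {G X : Type u} {s t : G → X} {D : Set (Composable s t)} (m : D → G) (g h k : G) :
    Prop :=
  ∃ p : D, p.1.1 = (g, h) ∧ m p = k

/-- Local groupoids `G ⇉ X` in the category of quasi-étale diffeological spaces. -/
structure LocalQUEDGroupoid (G X : Type u) [DiffeologicalSpace G] [DiffeologicalSpace X] where
  qued_arrows : IsQUED G
  qued_objects : IsQUED X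
  source : G → X
  target : G → X
  unit : X → G
  source_submersion : IsQUEDSubmersion source
  target_submersion : IsQUEDSubmersion target
  unit_smooth : DSmooth unit
  source_unit : ∀ x, source (unit x) = x
  target_unit : ∀ x, target (unit x) = x
  mulDomain : Set (Composable source target)
  mulDomain_open : DOpen mulDomain
  unit_mem_mulDomain : ∀ x,
    (⟨(unit x, unit x), (source_unit x).trans (target_unit x).symm⟩ :
      Composable source target) ∈ mulDomain
  mul : mulDomain → G
  mul_smooth : DSmooth mul
  invDomain : Set G
  invDomain_open : DOpen invDomain
  unit_mem_invDomain : ∀ x, unit x ∈ invDomain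
  inv : invDomain → G
  inv_smooth : DSmooth inv
  source_mul : ∀ g h k, IsProd mul g h k → source k = source h
  target_mul : ∀ g h k, IsProd mul g h k → target k = target g
  source_inv : ∀ g : invDomain, source (inv g) = target g
  unit_mul : ∀ g k, IsProd mul (unit (target g)) g k → k = g
  mul_unit : ∀ g k, IsProd mul g (unit (source g)) k → k = g
  mul_inv : ∀ (g : invDomain) (k : G), IsProd mul g (inv g) k → k = unit (target g)
  inv_mul : ∀ (g : invDomain) (k : G), IsProd mul (inv g) g k → k = unit (source g)
  mul_assoc : ∀ g h k gh hk a b, IsProd mul g h gh → IsProd mul h k hk →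
    IsProd mul g hk a → IsProd mul gh k b → a = b

namespace LocalQUEDGroupoid

variable {G X H Y K Z : Type u} [DiffeologicalSpace G] [DiffeologicalSpace X]
  [DiffeologicalSpace H] [DiffeologicalSpace Y] [DiffeologicalSpace K] [DiffeologicalSpace Z]

/-- Local singular Lie groupoids: the objects form a smooth manifold. -/
def IsSingularLie (_𝒢 : LocalQUEDGroupoid G X) : Prop :=
  IsSmoothManifold X

/-- Local Lie groupoids: both the arrows and the objects form smooth manifolds. -/
def IsLie (_𝒢 : LocalQUEDGroupoid G X) : Prop :=
  IsSmoothManifold G ∧ IsSmoothManifold X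

/-- The filter of neighborhoods, in the D-topology, of the set of units. -/
def nhdsUnits (𝒢 : LocalQUEDGroupoid G X) : Filter G :=
  @nhdsSet G DiffeologicalSpace.dTopology (Set.range 𝒢.unit)

/-- `F` is smooth on `U`, maps units to units, and is compatible on `U` with source, target and
multiplication (whenever the products involved are defined). -/
structure IsMorphismOn (𝒢 : LocalQUEDGroupoid G X) (ℋ : LocalQUEDGroupoid H Y)
    (f : X → Y) (F : G → H) (U : Set G) : Prop where
  smooth : DSmooth (fun g : U => F g)
  map_unit : ∀ x, F (𝒢.unit x) ∈ Set.range ℋ.unit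
  source_map : ∀ g ∈ U, ℋ.source (F g) = f (𝒢.source g)
  target_map : ∀ g ∈ U, ℋ.target (F g) = f (𝒢.target g)
  map_mul : ∀ g ∈ U, ∀ h ∈ U, ∀ k ∈ U, ∀ l : H,
    IsProd 𝒢.mul g h k → IsProd ℋ.mul (F g) (F h) l → F k = l

/-- A morphism of local groupoids covering `base`: a germ along the units, one of whose
representatives is a morphism on an open neighborhood of the units. -/
@[ext]
structure Hom (𝒢 : LocalQUEDGroupoid G X) (ℋ : LocalQUEDGroupoid H Y) where
  base : X → Y
  base_smooth : DSmooth base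
  germ : Filter.Germ 𝒢.nhdsUnits H
  exists_rep : ∃ (F : G → H) (U : Set G), (F : Filter.Germ 𝒢.nhdsUnits H) = germ ∧
    DOpen U ∧ Set.range 𝒢.unit ⊆ U ∧ IsMorphismOn 𝒢 ℋ base F U

/-- Preimages of open sets under a map that is smooth on an open set. -/
theorem dOpen_inter_preimage {F : G → H} {U : Set G} {V : Set H} (hU : DOpen U)
    (hF : DSmooth (fun g : U => F g)) (hV : DOpen V) : DOpen (U ∩ F ⁻¹' V) := by
  refine (isOpen_iff_preimages_plots (X := G)).2 fun n p hp => ?_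
  have hpU : IsOpen (p ⁻¹' U) := isOpen_iff_preimages_plots.1 hU n p hp
  rw [isOpen_iff_mem_nhds]
  rintro x ⟨hxU, hxV⟩
  obtain ⟨ε, hε, hball⟩ := Metric.isOpen_iff.1 hpU x hxU
  have hmem : ∀ y, p (OpenPartialHomeomorph.univBall x ε y) ∈ U := fun y => hball <| by
    have h := (OpenPartialHomeomorph.univBall x ε).map_source (x := y) (by simp)
    rwa [OpenPartialHomeomorph.univBall_target x hε] at h
  have hq : IsPlot (p ∘ OpenPartialHomeomorph.univBall x ε) :=
    isPlot_reparam hp OpenPartialHomeomorph.contDiff_univBall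
  have hq' : IsPlot (F ∘ p ∘ OpenPartialHomeomorph.univBall x ε) :=
    hF n (fun y => ⟨p (OpenPartialHomeomorph.univBall x ε y), hmem y⟩) hq
  have hopen := isOpen_iff_preimages_plots.1 hV n _ hq'
  have himg := (OpenPartialHomeomorph.univBall x ε).isOpen_image_of_subset_source hopen
    (by simp)
  refine Filter.mem_of_superset (himg.mem_nhds ⟨0, ?_, by simp⟩) ?_
  · simpa using hxV
  · rintro _ ⟨y, hy, rfl⟩
    exact ⟨hmem y, hy⟩

/-- Morphisms map neighborhoods of units to neighborhoods of units, so germs can be composed. -/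
theorem Hom.tendsto {𝒢 : LocalQUEDGroupoid G X} {ℋ : LocalQUEDGroupoid H Y} (φ : Hom 𝒢 ℋ) :
    φ.germ.Tendsto ℋ.nhdsUnits := by
  obtain ⟨F, U, hF, hU, hunit, hmor⟩ := φ.exists_rep
  rw [← hF, Filter.Germ.coe_tendsto]
  let _ : TopologicalSpace G := DiffeologicalSpace.dTopology
  let _ : TopologicalSpace H := DiffeologicalSpace.dTopology
  intro W hW
  obtain ⟨V, hV, hVr, hVW⟩ := mem_nhdsSet_iff_exists.1 hW
  refine mem_nhdsSet_iff_exists.2 ⟨U ∩ F ⁻¹' V, dOpen_inter_preimage hU hmor.smooth (show DOpen V from hV), ?_,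
    fun g hg => hVW hg.2⟩
  rintro _ ⟨x, rfl⟩
  exact ⟨hunit ⟨x, rfl⟩, hVr (hmor.map_unit x)⟩

/-- The composite `[ψ] ∘ [φ]` of the germs of two morphisms. -/
def Hom.germComp {𝒢 : LocalQUEDGroupoid G X} {ℋ : LocalQUEDGroupoid H Y}
    {𝒦 : LocalQUEDGroupoid K Z} (ψ : Hom ℋ 𝒦) (φ : Hom 𝒢 ℋ) :
    Filter.Germ 𝒢.nhdsUnits K :=
  ψ.germ.compTendsto' φ.germ φ.tendsto

/-- Local Lie groupoid charts of `𝒢 : G ⇉ M`: an open subset of `M` (the set `objects`), a local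
Lie groupoid over it, and a quasi-étale map `π` from its arrows to `G` whose germ is a morphism
of local groupoids covering the inclusion. -/
structure LieChart {M : Type u} [DiffeologicalSpace M] (𝒢 : LocalQUEDGroupoid G M) where
  objects : Set M
  objects_open : DOpen objects
  arrows : Type u
  [arrowsDiffeology : DiffeologicalSpace arrows]
  groupoid : LocalQUEDGroupoid arrows objects
  isLie : groupoid.IsLie
  π : arrows → G
  quasiEtale : IsQuasiEtale π
  hom : Hom groupoid 𝒢
  hom_germ : hom.germ = (π : Filter.Germ groupoid.nhdsUnits G)
  hom_base : hom.base = Subtype.val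

attribute [instance] LieChart.arrowsDiffeology

/-- A chart is wide when its set of objects is the whole object manifold. -/
def LieChart.IsWide {M : Type u} [DiffeologicalSpace M] {𝒢 : LocalQUEDGroupoid G M}
    (c : LieChart 𝒢) : Prop :=
  c.objects = Set.univ

end LocalQUEDGroupoid

end SingLie

open SingLie

/-!
Let `𝒜` and `ℬ` be the local Lie groupoids of the two charts, `π` the chart map of `ℬ`, and `Φ` the
composite of the given morphism with the chart map of `𝒜`. The claim is that the germ of `Φ` lifts
uniquely through the quasi-étale map `π`. Lifts of arbitrary smooth maps through `π` are far from
unique, even when their value at a point is prescribed; what makes lifts of morphisms unique is that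
they take units to units, together with the following principle, which is
`exists_nhds_forall_path_eq`. Near the units, a smooth path `a` inside a *source fiber* of `ℬ` is
determined by `π ∘ a` and one of its values. Indeed, for a second such path `b`, the path `b⁻¹ a`
lies in a single fiber of `π`, and these fibers are totally disconnected.

* Uniqueness (`IsLiftNear.eventuallyEq`): source maps are submersions, so each arrow close to a unit
  is joined to a unit by a short path in its source fiber (`eventually_exists_path`).
* Existence near one unit (`exists_isLiftNear`): as `π` is a local subduction, `Φ` has a smooth lift
  `ψ`, and `g ↦ ψ g * (ψ (u (s g)))⁻¹` is a lift that takes units to units.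
* Multiplicativity (`IsLiftNear.map_mul`): `F (c h)` and `F c * F h` lift the same path, if `c` is a
  path from a unit to `g` in the source fiber of `g`.
* Globalization (`exists_forall_isLiftNear`, `exists_isMorphismOn_of_isLiftNear`): local lifts have
  equal germs, so they glue along the units, by means of a locally finite closed cover of the
  manifold of objects.

Two points need care. Products of arrows are defined on a set that is open in the D-topology of the
space of composable pairs, which for singular groupoids can be finer than the topology of a
subspace of a product. Only composable pairs of a local *Lie* groupoid are ever required to be close to
a pair of units, and these are parametrized by plots (`exists_plots_composable`). Secondly,
the axioms on the inverse map of a local groupoid are conditional on products being defined, so they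
can be void. Inverses in `ℬ` are constructed from the multiplication by the inverse function
theorem (`exists_inv`).
-/

namespace SingLie

open Diffeology Filter Topology ContDiff

/-! ### Germs of smooth maps in the D-topology -/

section Germs

variable {X Y Z : Type*} [DiffeologicalSpace X] [DiffeologicalSpace Y] [DiffeologicalSpace Z]

/-- The neighborhood filter of a point for the D-topology. The D-topology is not an instance, so
it gets its own name. -/
def dnhds (x : X) : Filter X := @nhds X DiffeologicalSpace.dTopology x

theorem mem_dnhds_iff {x : X} {S : Set X} :
    S ∈ dnhds x ↔ ∃ U ⊆ S, DOpen U ∧ x ∈ U :=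
  @mem_nhds_iff X DiffeologicalSpace.dTopology x S

theorem DOpen.mem_dnhds {U : Set X} (hU : DOpen U) {x : X} (hx : x ∈ U) : U ∈ dnhds x :=
  mem_dnhds_iff.2 ⟨U, subset_rfl, hU, hx⟩

theorem DOpen.inter {U V : Set X} (hU : DOpen U) (hV : DOpen V) : DOpen (U ∩ V) :=
  @IsOpen.inter X DiffeologicalSpace.dTopology U V hU hV

theorem self_of_dnhds {x : X} {p : X → Prop} (h : ∀ᶠ y in dnhds x, p y) : p x :=
  @Eventually.self_of_nhds X DiffeologicalSpace.dTopology x p h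

theorem eventually_eventually_dnhds {x : X} {p : X → Prop} :
    (∀ᶠ y in dnhds x, ∀ᶠ z in dnhds y, p z) ↔ ∀ᶠ y in dnhds x, p y :=
  @eventually_eventually_nhds X DiffeologicalSpace.dTopology x p

theorem dOpen_iff_mem_dnhds {U : Set X} : DOpen U ↔ ∀ x ∈ U, U ∈ dnhds x :=
  @isOpen_iff_mem_nhds X DiffeologicalSpace.dTopology U

theorem dOpen_setOf_eventually (p : X → Prop) : DOpen {x | ∀ᶠ y in dnhds x, p y} :=
  dOpen_iff_mem_dnhds.2 fun _ hx => eventually_eventually_dnhds.2 hx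

theorem dnhds_euclidean {n : ℕ} (x : EuclideanSpace ℝ (Fin n)) : dnhds x = 𝓝 x := rfl

theorem _root_.Diffeology.DSmooth.tendsto_dnhds {f : X → Y} (hf : DSmooth f) (x : X) :
    Tendsto f (dnhds x) (dnhds (f x)) :=
  (@continuous_iff_continuousAt X Y DiffeologicalSpace.dTopology DiffeologicalSpace.dTopology f).1
    hf.continuous x

theorem _root_.Diffeology.IsPlot.tendsto_dnhds {n : ℕ} {p : EuclideanSpace ℝ (Fin n) → X}
    (hp : IsPlot p) (x : EuclideanSpace ℝ (Fin n)) : Tendsto p (𝓝 x) (dnhds (p x)) :=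
  hp.dSmooth.tendsto_dnhds x

/-- Around any point of an open set, the Euclidean space contains a copy of itself. -/
theorem exists_contDiff_into_open {n : ℕ} {W : Set (EuclideanSpace ℝ (Fin n))} (hW : IsOpen W)
    {x : EuclideanSpace ℝ (Fin n)} (hx : x ∈ W) :
    ∃ q r : EuclideanSpace ℝ (Fin n) → EuclideanSpace ℝ (Fin n), ContDiff ℝ ∞ q ∧ q 0 = x ∧
      (∀ y, q y ∈ W) ∧ IsOpen (Set.range q) ∧ ContDiffOn ℝ ∞ r (Set.range q) ∧
      (∀ y, r (q y) = y) ∧ ∀ S : Set (EuclideanSpace ℝ (Fin n)), IsOpen S → IsOpen (q '' S) := by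
  obtain ⟨ε, hε, hball⟩ := Metric.isOpen_iff.1 hW x hx
  have hsrc : (OpenPartialHomeomorph.univBall x ε).source = Set.univ := by simp
  have hrange : Set.range (OpenPartialHomeomorph.univBall x ε) = Metric.ball x ε := by
    have h := (OpenPartialHomeomorph.univBall x ε).image_source_eq_target
    rwa [hsrc, Set.image_univ, OpenPartialHomeomorph.univBall_target x hε] at h
  refine ⟨OpenPartialHomeomorph.univBall x ε, (OpenPartialHomeomorph.univBall x ε).symm,
    OpenPartialHomeomorph.contDiff_univBall, by simp, fun y => hball (hrange ▸ ⟨y, rfl⟩),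
    hrange ▸ Metric.isOpen_ball, hrange ▸ OpenPartialHomeomorph.contDiffOn_univBall_symm,
    fun y => (OpenPartialHomeomorph.univBall x ε).left_inv (by simp), fun S hS =>
    (OpenPartialHomeomorph.univBall x ε).isOpen_image_of_subset_source hS (by simp)⟩

theorem dSmooth_restrict_iff {f : X → Y} {U : Set X} :
    DSmooth (fun g : U => f g) ↔ ∀ (n : ℕ) (p : EuclideanSpace ℝ (Fin n) → X),
      IsPlot p → (∀ a, p a ∈ U) → IsPlot (f ∘ p) :=
  ⟨fun h n p hp hU => h n (fun a => ⟨p a, hU a⟩) hp,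
    fun h n p hp => h n (fun a => (p a : X)) hp fun a => (p a).2⟩

/-- The map `f` is smooth on some D-open neighborhood of `x`. -/
def SmoothNear (f : X → Y) (x : X) : Prop :=
  ∃ U : Set X, DOpen U ∧ x ∈ U ∧ DSmooth (fun g : U => f g)

theorem _root_.Diffeology.DSmooth.smoothNear {f : X → Y} (hf : DSmooth f) (x : X) :
    SmoothNear f x :=
  ⟨Set.univ, @isOpen_univ X DiffeologicalSpace.dTopology, trivial,
    dSmooth_restrict_iff.2 fun n p hp _ => hf n p hp⟩

theorem SmoothNear.eventually {f : X → Y} {x : X} (hf : SmoothNear f x) :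
    ∀ᶠ y in dnhds x, SmoothNear f y := by
  obtain ⟨U, hU, hx, hs⟩ := hf
  filter_upwards [hU.mem_dnhds hx] with y hy using ⟨U, hU, hy, hs⟩

theorem SmoothNear.congr {f g : X → Y} {x : X} (hf : SmoothNear f x) (h : f =ᶠ[dnhds x] g) :
    SmoothNear g x := by
  obtain ⟨U, hU, hx, hs⟩ := hf
  obtain ⟨V, hVs, hV, hxV⟩ := mem_dnhds_iff.1 h
  refine ⟨U ∩ V, hU.inter hV, ⟨hx, hxV⟩, dSmooth_restrict_iff.2 fun n p hp hm => ?_⟩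
  have : g ∘ p = f ∘ p := funext fun a => (hVs (hm a).2).symm
  exact this ▸ dSmooth_restrict_iff.1 hs n p hp fun a => (hm a).1

/-- A map that is smooth near every point of a plot turns that plot into a plot: the locality
axiom of diffeologies. -/
theorem SmoothNear.isPlot_comp {f : X → Y} {n : ℕ} {p : EuclideanSpace ℝ (Fin n) → X}
    (hp : IsPlot p) (hf : ∀ a, SmoothNear f (p a)) : IsPlot (f ∘ p) := by
  refine DiffeologicalSpace.locality fun x => ?_
  obtain ⟨U, hU, hx, hs⟩ := hf x
  refine ⟨p ⁻¹' U, isOpen_iff_preimages_plots.1 hU n p hp, hx, fun {m q} hq hqs => ?_⟩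
  exact dSmooth_restrict_iff.1 hs m (p ∘ q) (isPlot_reparam hp hqs) hq

theorem dSmooth_restrict_of_smoothNear {f : X → Y} {U : Set X} (h : ∀ x ∈ U, SmoothNear f x) :
    DSmooth (fun g : U => f g) :=
  dSmooth_restrict_iff.2 fun _ _ hp hm => SmoothNear.isPlot_comp hp fun a => h _ (hm a)

/-- Preimages of D-open sets under maps that are smooth on a D-open set. -/
theorem DOpen.inter_preimage {f : X → Y} {U : Set X} {V : Set Y} (hU : DOpen U)
    (hf : DSmooth (fun g : U => f g)) (hV : DOpen V) : DOpen (U ∩ f ⁻¹' V) := by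
  refine (isOpen_iff_preimages_plots (X := X)).2 fun n p hp => ?_
  refine isOpen_iff_mem_nhds.2 fun x hx => ?_
  obtain ⟨q, -, hq, hq0, hqU, -, -, -, hqo⟩ :=
    exists_contDiff_into_open (isOpen_iff_preimages_plots.1 hU n p hp) hx.1
  have hopen := isOpen_iff_preimages_plots.1 hV n _
    (dSmooth_restrict_iff.1 hf n (p ∘ q) (isPlot_reparam hp hq) hqU)
  refine mem_of_superset ((hqo _ hopen).mem_nhds ⟨0, ?_, hq0⟩) ?_
  · simpa [hq0] using hx.2
  · rintro _ ⟨y, hy, rfl⟩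
    exact ⟨hqU y, hy⟩

theorem SmoothNear.tendsto {f : X → Y} {x : X} (hf : SmoothNear f x) :
    Tendsto f (dnhds x) (dnhds (f x)) := by
  obtain ⟨U, hU, hx, hs⟩ := hf
  intro S hS
  obtain ⟨V, hVS, hV, hxV⟩ := mem_dnhds_iff.1 hS
  exact mem_dnhds_iff.2 ⟨U ∩ f ⁻¹' V, fun y hy => hVS hy.2, hU.inter_preimage hs hV, hx, hxV⟩

theorem SmoothNear.comp {g : Y → Z} {f : X → Y} {x : X} (hg : SmoothNear g (f x))
    (hf : SmoothNear f x) : SmoothNear (g ∘ f) x := by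
  obtain ⟨U, hU, hx, hs⟩ := hf
  obtain ⟨V, hV, hxV, ht⟩ := hg
  refine ⟨U ∩ f ⁻¹' V, hU.inter_preimage hs hV, ⟨hx, hxV⟩,
    dSmooth_restrict_iff.2 fun n p hp hm => ?_⟩
  exact dSmooth_restrict_iff.1 ht n (f ∘ p)
    (dSmooth_restrict_iff.1 hs n p hp fun a => (hm a).1) fun a => (hm a).2

theorem SmoothNear.comp_of_eq {g : Y → Z} {f : X → Y} {x : X} {y : Y} (hg : SmoothNear g y)
    (hf : SmoothNear f x) (h : f x = y) : SmoothNear (fun z => g (f z)) x :=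
  SmoothNear.comp (h ▸ hg) hf

theorem SmoothNear.tendsto_of_eq {f : X → Y} {x : X} {y : Y} (hf : SmoothNear f x)
    (h : f x = y) : Tendsto f (dnhds x) (dnhds y) :=
  h ▸ hf.tendsto

theorem SmoothNear.isPlot {n : ℕ} {p : EuclideanSpace ℝ (Fin n) → X}
    (h : ∀ a, SmoothNear p a) : IsPlot p :=
  SmoothNear.isPlot_comp isPlot_id h

theorem smoothNear_of_contDiffAt {n m : ℕ} {f : EuclideanSpace ℝ (Fin n) → EuclideanSpace ℝ (Fin m)}
    {x : EuclideanSpace ℝ (Fin n)} (h : ∀ᶠ y in 𝓝 x, ContDiffAt ℝ ∞ f y) : SmoothNear f x := by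
  obtain ⟨U, hUs, hU, hx⟩ := mem_nhds_iff.1 h
  refine ⟨U, hU, hx, dSmooth_restrict_iff.2 fun k p hp hm => ContDiff.isPlot ?_⟩
  exact contDiff_iff_contDiffAt.2 fun a =>
    ContDiffAt.comp a (hUs (hm a)) hp.contDiff.contDiffAt

theorem SmoothNear.contDiffAt {n m : ℕ}
    {f : EuclideanSpace ℝ (Fin n) → EuclideanSpace ℝ (Fin m)}
    {x : EuclideanSpace ℝ (Fin n)} (h : SmoothNear f x) : ContDiffAt ℝ ∞ f x := by
  obtain ⟨U, hU, hx, hs⟩ := h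
  obtain ⟨q, r, hq, hq0, hqU, hqo, hr, hrq, -⟩ := exists_contDiff_into_open hU hx
  have h1 : ContDiff ℝ ∞ (f ∘ q) := (dSmooth_restrict_iff.1 hs n q hq.isPlot hqU).contDiff
  have h2 : ContDiffOn ℝ ∞ ((f ∘ q) ∘ r) (Set.range q) := h1.comp_contDiffOn hr
  have hmem : Set.range q ∈ 𝓝 x := hqo.mem_nhds ⟨0, hq0⟩
  refine (h2.contDiffAt hmem).congr_of_eventuallyEq ?_
  filter_upwards [hmem] with _ hy
  obtain ⟨y, rfl⟩ := hy
  simp [hrq]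

theorem SmoothNear.eventually_contDiffAt {n m : ℕ}
    {f : EuclideanSpace ℝ (Fin n) → EuclideanSpace ℝ (Fin m)}
    {x : EuclideanSpace ℝ (Fin n)} (h : SmoothNear f x) : ∀ᶠ y in 𝓝 x, ContDiffAt ℝ ∞ f y := by
  have h' := h.eventually
  rw [dnhds_euclidean] at h'
  exact h'.mono fun _ hy => hy.contDiffAt

end Germs

/-! ### Submersions between Euclidean spaces -/

section Calculus

variable {E F : Type*} [NormedAddCommGroup E] [NormedSpace ℝ E] [CompleteSpace E]
  [NormedAddCommGroup F] [NormedSpace ℝ F] [CompleteSpace F]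

/-- The continuous linear equivalence `(x, w) ↦ (A x + w, x)`. -/
def shearEquiv (A : E →L[ℝ] F) : (E × F) ≃L[ℝ] (F × E) :=
  ContinuousLinearEquiv.equivOfInverse
    ((A.comp (ContinuousLinearMap.fst ℝ E F) + ContinuousLinearMap.snd ℝ E F).prod
      (ContinuousLinearMap.fst ℝ E F))
    ((ContinuousLinearMap.snd ℝ F E).prod
      (ContinuousLinearMap.fst ℝ F E - A.comp (ContinuousLinearMap.snd ℝ F E)))
    (fun z => by ext <;> simp) (fun z => by ext <;> simp)

/-- The inverse function theorem for a map `z ↦ (q z, z.1)` on `E × F` whose derivative is a shear. -/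
theorem exists_openPartialHomeomorph_of_shear {q : E × F → F} {z₀ : E × F} {A : E →L[ℝ] F}
    (hq : ∀ᶠ z in 𝓝 z₀, ContDiffAt ℝ ∞ q z)
    (hA : HasFDerivAt q (A.comp (ContinuousLinearMap.fst ℝ E F) + ContinuousLinearMap.snd ℝ E F)
      z₀) :
    ∃ h : OpenPartialHomeomorph (E × F) (F × E), (∀ z, h z = (q z, z.1)) ∧ z₀ ∈ h.source ∧
      ∀ᶠ z in 𝓝 (q z₀, z₀.1), ContDiffAt ℝ ∞ h.symm z := by
  have htop : (∞ : WithTop ℕ∞) ≠ 0 := by simp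
  set Ψ : E × F → F × E := fun z => (q z, z.1)
  have hΨs : ∀ᶠ z in 𝓝 z₀, ContDiffAt ℝ ∞ Ψ z :=
    hq.mono fun z hz => hz.prodMk contDiffAt_fst
  have hΨ0 : HasFDerivAt Ψ (shearEquiv A : E × F →L[ℝ] F × E) z₀ := by
    refine (hA.prodMk hasFDerivAt_fst).congr_fderiv ?_
    ext z <;> simp [shearEquiv]
  set h := hΨs.self_of_nhds.toOpenPartialHomeomorph Ψ hΨ0 htop
  have hmem : z₀ ∈ h.source :=
    hΨs.self_of_nhds.mem_toOpenPartialHomeomorph_source hΨ0 htop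
  have hmem' : Ψ z₀ ∈ h.target := h.map_source hmem
  have hst : Tendsto h.symm (𝓝 (Ψ z₀)) (𝓝 z₀) := by
    have := (h.symm.continuousAt (x := Ψ z₀) hmem').tendsto
    rwa [show h.symm (Ψ z₀) = z₀ from h.left_inv hmem] at this
  have hinv : ∀ᶠ z in 𝓝 z₀,
      fderiv ℝ Ψ z ∈ Set.range ((↑) : ((E × F) ≃L[ℝ] (F × E)) → (E × F →L[ℝ] F × E)) := by
    have hc : ContinuousAt (fderiv ℝ Ψ) z₀ :=
      (hΨs.self_of_nhds.fderiv_right (m := 0) (by simp)).continuousAt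
    refine hc.eventually ?_
    rw [hΨ0.fderiv]
    exact ContinuousLinearEquiv.nhds _
  refine ⟨h, fun z => rfl, hmem, ?_⟩
  filter_upwards [h.open_target.mem_nhds hmem', hst.eventually hinv, hst.eventually hΨs]
    with z hz ⟨e, he⟩ hzs
  refine h.contDiffAt_symm (f₀' := e) hz ?_ hzs
  rw [he]
  exact (hzs.differentiableAt htop).hasFDerivAt

/-- A smooth map `P` with a smooth local section through `x₀` has a smooth family of local
retractions onto its fibers: `r (y, x)` lies in the fiber over `y`, and equals `x` when `x` is in
that fiber already. The displacement `r (y, x) - x` is transversal to the fibers: it can only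
join two points of the same fiber when it is zero. -/
theorem exists_fiber_retraction {P : E → F} {σ : F → E} {x₀ : E}
    (hP : ∀ᶠ x in 𝓝 x₀, ContDiffAt ℝ ∞ P x) (hσ : ContDiffAt ℝ ∞ σ (P x₀)) (hσ₀ : σ (P x₀) = x₀)
    (hPσ : ∀ᶠ y in 𝓝 (P x₀), P (σ y) = y) :
    ∃ r : F × E → E, r (P x₀, x₀) = x₀ ∧ (∀ᶠ z in 𝓝 (P x₀, x₀), ContDiffAt ℝ ∞ r z) ∧
      (∀ᶠ z in 𝓝 (P x₀, x₀), P (r z) = z.1) ∧ (∀ᶠ x in 𝓝 x₀, r (P x, x) = x) ∧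
      ∀ᶠ q in 𝓝 x₀ ×ˢ 𝓝 (P x₀, x₀), P (q.1 + (r q.2 - q.2.2)) = P q.1 → r q.2 = q.2.2 := by
  have htop : (∞ : WithTop ℕ∞) ≠ 0 := by simp
  set L : F →L[ℝ] E := fderiv ℝ σ (P x₀)
  -- `T` moves `x` transversally to the fibers.
  set T : E × F → E := fun z => z.1 + L z.2 with hT
  have hTs : ContDiff ℝ ∞ T := contDiff_fst.add (L.contDiff.comp contDiff_snd)
  have hT0 : T (x₀, 0) = x₀ := by simp [hT]
  have hTt : Tendsto T (𝓝 (x₀, 0)) (𝓝 x₀) := by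
    have := hTs.continuous.tendsto (x₀, (0 : F)); rwa [hT0] at this
  have hPT : ∀ᶠ z in 𝓝 (x₀, (0 : F)), ContDiffAt ℝ ∞ (P ∘ T) z :=
    (hTt.eventually hP).mono fun z hz => hz.comp z hTs.contDiffAt
  have hP0 : HasFDerivAt P (fderiv ℝ P x₀) x₀ :=
    (hP.self_of_nhds.differentiableAt htop).hasFDerivAt
  have hPL : (fderiv ℝ P x₀).comp L = ContinuousLinearMap.id ℝ F := by
    have h1 : HasFDerivAt (P ∘ σ) ((fderiv ℝ P x₀).comp L) (P x₀) := by
      refine HasFDerivAt.comp _ ?_ (hσ.differentiableAt htop).hasFDerivAt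
      rwa [hσ₀]
    exact h1.unique ((hasFDerivAt_id (𝕜 := ℝ) (P x₀)).congr_of_eventuallyEq hPσ)
  have hPT0 : HasFDerivAt (P ∘ T) ((fderiv ℝ P x₀).comp (ContinuousLinearMap.fst ℝ E F) +
      ContinuousLinearMap.snd ℝ E F) (x₀, 0) := by
    have hTd : HasFDerivAt T
        (ContinuousLinearMap.fst ℝ E F + L.comp (ContinuousLinearMap.snd ℝ E F)) (x₀, 0) :=
      hasFDerivAt_fst.add (L.hasFDerivAt.comp _ hasFDerivAt_snd)
    have h1 : HasFDerivAt (P ∘ T) ((fderiv ℝ P x₀).comp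
        (ContinuousLinearMap.fst ℝ E F + L.comp (ContinuousLinearMap.snd ℝ E F))) (x₀, 0) :=
      HasFDerivAt.comp _ (by rwa [hT0]) hTd
    refine h1.congr_fderiv ?_
    rw [ContinuousLinearMap.comp_add, ← ContinuousLinearMap.comp_assoc, hPL,
      ContinuousLinearMap.id_comp]
  obtain ⟨h, hh, hmem, hsymm⟩ := exists_openPartialHomeomorph_of_shear hPT hPT0
  have hx : h (x₀, 0) = (P x₀, x₀) := by simp [hh, hT0]
  simp only [Function.comp, hT0] at hsymm
  have hmem' : (P x₀, x₀) ∈ h.target := hx ▸ h.map_source hmem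
  have hsymm0 : h.symm (P x₀, x₀) = (x₀, 0) := by
    rw [← hx]; exact h.left_inv hmem
  have htgt : ∀ᶠ z in 𝓝 (P x₀, x₀), z ∈ h.target := h.open_target.mem_nhds hmem'
  have hi : Tendsto (fun x : E => (x, (0 : F))) (𝓝 x₀) (𝓝 (x₀, 0)) :=
    (Continuous.prodMk_left (0 : F)).tendsto x₀
  refine ⟨fun z => T (h.symm z), by simp [hsymm0, hT0], ?_, ?_, ?_, ?_⟩
  · exact hsymm.mono fun z hz => hTs.contDiffAt.comp z hz
  · filter_upwards [htgt] with z hz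
    have := h.right_inv hz
    rw [hh] at this
    exact congrArg Prod.fst this
  · filter_upwards [hi.eventually (h.open_source.mem_nhds hmem)] with x hx
    have hx' : h (x, 0) = (P x, x) := by rw [hh]; simp [hT]
    change T (h.symm (P x, x)) = x
    rw [← hx', h.left_inv hx]
    simp [hT]
  · have hst : Tendsto (fun q : E × (F × E) => (q.1, (h.symm q.2).2))
        (𝓝 x₀ ×ˢ 𝓝 (P x₀, x₀)) (𝓝 (x₀, 0)) := by
      rw [nhds_prod_eq (x := x₀) (y := (0 : F))]
      have h1 : Tendsto h.symm (𝓝 (P x₀, x₀)) (𝓝 (x₀, 0)) := by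
        have := (h.symm.continuousAt (x := (P x₀, x₀)) hmem').tendsto
        rwa [hsymm0] at this
      exact tendsto_id.prodMap ((continuous_snd.tendsto _).comp h1)
    filter_upwards [tendsto_snd.eventually htgt, hst.eventually (h.open_source.mem_nhds hmem),
      tendsto_fst.eventually (hi.eventually (h.open_source.mem_nhds hmem))] with q h1 h2 h3 h4
    have h5 : (h.symm q.2).1 = q.2.2 := by
      have := h.right_inv h1
      rw [hh] at this
      exact congrArg Prod.snd this
    have h6 : T (h.symm q.2) - q.2.2 = L (h.symm q.2).2 := by simp [hT, h5]
    have h7 : h (q.1, (h.symm q.2).2) = h (q.1, 0) := by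
      rw [h6] at h4
      rw [hh, hh]
      simp [hT, h4]
    have h8 : (h.symm q.2).2 = 0 := congrArg Prod.snd (h.injOn h2 h3 h7)
    rw [h8, map_zero, sub_eq_zero] at h6
    exact h6

end Calculus

/-! ### Charts and locally finite covers of manifolds -/

section Manifolds

variable {X Y : Type*} [DiffeologicalSpace X] [DiffeologicalSpace Y]

/-- Around each point of a manifold there is a chart `ξ` whose inverse `φ` is defined on a whole
Euclidean space. -/
theorem IsSmoothManifold.exists_chart (hX : IsSmoothManifold X) (x : X) :
    ∃ (n : ℕ) (φ : EuclideanSpace ℝ (Fin n) → X) (ξ : X → EuclideanSpace ℝ (Fin n)),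
      IsPlot φ ∧ φ 0 = x ∧ (∀ v, ξ (φ v) = v) ∧ (∀ v, SmoothNear ξ (φ v)) ∧
        ∀ v, ∀ᶠ y in dnhds (φ v), φ (ξ y) = y := by
  classical
  obtain ⟨n, U, V, e, hU, hx, hV, he, hes⟩ := hX.charts x
  obtain ⟨q, r, hq, hq0, hqV, hqo, hr, hrq, -⟩ := exists_contDiff_into_open hV (e ⟨x, hx⟩).2
  set g : X → EuclideanSpace ℝ (Fin n) := fun y => if h : y ∈ U then (e ⟨y, h⟩ : _) else 0 with hg
  have hgU : ∀ y (h : y ∈ U), g y = e ⟨y, h⟩ := fun y h => by simp [hg, h]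
  have hgs : DSmooth (fun y : U => g y) := by
    refine dSmooth_restrict_iff.2 fun m p hp hm => ?_
    have : g ∘ p = fun a => (e ⟨p a, hm a⟩ : EuclideanSpace ℝ (Fin n)) :=
      funext fun a => hgU _ (hm a)
    rw [this]
    exact he m (fun a => ⟨p a, hm a⟩) hp
  set φ : EuclideanSpace ℝ (Fin n) → X := fun v => (e.symm ⟨q v, hqV v⟩ : X) with hφ
  have hφU : ∀ v, φ v ∈ U := fun v => (e.symm ⟨q v, hqV v⟩).2
  have hgφ : ∀ v, g (φ v) = q v := fun v => by
    rw [hgU _ (hφU v)]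
    simp [hφ]
  have hW : DOpen (U ∩ g ⁻¹' Set.range q) := hU.inter_preimage hgs hqo
  refine ⟨n, φ, r ∘ g, hes n (fun v => ⟨q v, hqV v⟩) hq.isPlot, ?_, fun v => ?_, fun v => ?_,
    fun v => ?_⟩
  · have : (⟨q 0, hqV 0⟩ : V) = e ⟨x, hx⟩ := Subtype.ext hq0
    simp [hφ, this]
  · simp [hgφ, hrq]
  · refine SmoothNear.comp ?_ ⟨U, hU, hφU v, hgs⟩
    refine smoothNear_of_contDiffAt ?_
    filter_upwards [hqo.mem_nhds ⟨v, (hgφ v).symm⟩] with w hw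
    exact hr.contDiffAt (hqo.mem_nhds hw)
  · filter_upwards [hW.mem_dnhds ⟨hφU v, ⟨v, (hgφ v).symm⟩⟩] with y hy
    obtain ⟨hyU, w, hw⟩ := hy
    have : (⟨q w, hqV w⟩ : V) = e ⟨y, hyU⟩ := Subtype.ext (hw.trans (hgU y hyU))
    simp [hφ, ← hw, hrq, this]

/-- Every family of neighborhoods of the points of a manifold is refined by a locally finite closed
cover. -/
theorem IsSmoothManifold.exists_closed_cover (hX : IsSmoothManifold X) {W : X → Set X}
    (hW : ∀ x, W x ∈ dnhds x) :
    ∃ C : X → Set X, (∀ y, ∃ i, y ∈ C i) ∧ (∀ i, C i ⊆ W i) ∧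
      ∀ x, {i | x ∈ C i}.Finite ∧ ∀ᶠ y in dnhds x, ∀ i, y ∈ C i → x ∈ C i := by
  let _ : TopologicalSpace X := DiffeologicalSpace.dTopology
  have := hX.t2
  have := hX.secondCountable
  have : WeaklyLocallyCompactSpace X := by
    refine ⟨fun x => ?_⟩
    obtain ⟨n, φ, ξ, hφ, hφ0, hξφ, hξ, hφξ⟩ := hX.exists_chart x
    refine ⟨φ '' Metric.closedBall 0 1,
      (isCompact_closedBall _ _).image (hφ.continuous), ?_⟩
    have h1 : Tendsto ξ (dnhds x) (𝓝 0) := (hφ0 ▸ hξ 0 : SmoothNear ξ x).tendsto_of_eq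
      (by rw [← hφ0, hξφ])
    have h2 : ∀ᶠ y in dnhds x, φ (ξ y) = y := hφ0 ▸ hφξ 0
    change _ ∈ dnhds x
    filter_upwards [h1.eventually (Metric.closedBall_mem_nhds 0 one_pos), h2] with y hy hy'
    exact ⟨ξ y, hy, hy'⟩
  choose V hVW hV hxV using fun x => mem_dnhds_iff.1 (hW x)
  obtain ⟨v, hv, hvc, hvf, hvV⟩ := precise_refinement V hV
    (Set.eq_univ_of_forall fun x => Set.mem_iUnion.2 ⟨x, hxV x⟩)
  obtain ⟨C, hCc, hC, hCv⟩ := exists_iUnion_eq_closed_subset hv (fun x => hvf.point_finite x) hvc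
  have hCf : LocallyFinite C := hvf.subset hCv
  refine ⟨C, fun y => Set.mem_iUnion.1 (hCc ▸ Set.mem_univ y),
    fun i => (hCv i).trans ((hvV i).trans (hVW i)), fun x => ⟨hCf.point_finite x, ?_⟩⟩
  exact hCf.eventually_subset hC x

/-- A local subduction `p` between manifolds is a submersion: in suitable charts, there is a smooth
family `r` of local retractions onto its fibers. Here `φ` is the inverse of a chart `ξ` at `x`,
and `η` is a chart at `p x`. The displacement `r (y, v) - v` only joins points of the same fiber when
it is zero. -/
theorem IsLocalSubduction.exists_fiber_retraction (hX : IsSmoothManifold X)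
    (hY : IsSmoothManifold Y) {p : X → Y} (hp : IsLocalSubduction p) (x : X) :
    ∃ (n k : ℕ) (φ : EuclideanSpace ℝ (Fin n) → X) (ξ : X → EuclideanSpace ℝ (Fin n))
      (η : Y → EuclideanSpace ℝ (Fin k))
      (r : EuclideanSpace ℝ (Fin k) × EuclideanSpace ℝ (Fin n) → EuclideanSpace ℝ (Fin n)),
      IsPlot φ ∧ φ 0 = x ∧ (∀ v, ξ (φ v) = v) ∧ SmoothNear ξ x ∧ (∀ᶠ x' in dnhds x, φ (ξ x') = x') ∧
      η (p x) = 0 ∧ SmoothNear η (p x) ∧ r (0, 0) = 0 ∧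
      (∀ᶠ z in 𝓝 (0, 0), ContDiffAt ℝ ∞ r z) ∧
      (∀ᶠ q in dnhds (p x) ×ˢ 𝓝 0, p (φ (r (η q.1, q.2))) = q.1) ∧
      (∀ᶠ x' in dnhds x, r (η (p x'), ξ x') = ξ x') ∧
      ∀ᶠ q in 𝓝 0 ×ˢ 𝓝 (0, 0), p (φ (q.1 + (r q.2 - q.2.2))) = p (φ q.1) → r q.2 = q.2.2 := by
  obtain ⟨n, φ, ξ, hφ, rfl, hξφ, hξ, hφξ⟩ := hX.exists_chart x
  obtain ⟨k, θ, η, hθ, hθ0, hηθ, hη, hθη⟩ := hY.exists_chart (p (φ 0))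
  replace hη : SmoothNear η (p (φ 0)) := hθ0 ▸ hη 0
  replace hθη : ∀ᶠ y in dnhds (p (φ 0)), θ (η y) = y := hθ0 ▸ hθη 0
  have hη0 : η (p (φ 0)) = 0 := by rw [← hθ0, hηθ]
  set P : EuclideanSpace ℝ (Fin n) → EuclideanSpace ℝ (Fin k) := fun v => η (p (φ v)) with hP
  have hPs : SmoothNear P 0 :=
    SmoothNear.comp_of_eq (f := fun v => p (φ v)) hη
      ((hp.smooth.comp hφ.dSmooth).smoothNear 0) rfl
  obtain ⟨V, hVU, ha, ψ, hV, hψ, hψ0, hψp⟩ := hp.lift k Set.univ isOpen_univ (fun w => θ w)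
    (fun m q hq => hθ.dSmooth m _ hq) ⟨0, trivial⟩ (φ 0) hθ0
  set ψ' : EuclideanSpace ℝ (Fin k) → X :=
    fun w => open Classical in if h : w ∈ V then ψ ⟨w, h⟩ else φ 0 with hψ'
  have hψ's : SmoothNear ψ' 0 := by
    refine ⟨V, hV, ha, ?_⟩
    have : (fun w : V => ψ' w) = ψ := funext fun w => by simp [hψ']
    rwa [this]
  have hψ'0 : ψ' 0 = φ 0 := by simpa [hψ', ha] using hψ0
  have hσs : SmoothNear (fun w => ξ (ψ' w)) 0 := SmoothNear.comp_of_eq (hξ 0) hψ's hψ'0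
  have hσP : ∀ᶠ w in 𝓝 (0 : EuclideanSpace ℝ (Fin k)), P (ξ (ψ' w)) = w := by
    filter_upwards [hV.mem_nhds ha, (hψ's.tendsto_of_eq hψ'0).eventually (hφξ 0)] with w hw hw'
    have hw'' : ψ' w = ψ ⟨w, hw⟩ := by simp [hψ', hw]
    rw [hP]
    beta_reduce
    rw [hw', hw'', hψp ⟨w, hw⟩, hηθ]
  obtain ⟨r, hr0, hrs, hPr, hrP, hri⟩ := SingLie.exists_fiber_retraction (x₀ := 0)
    (σ := fun w => ξ (ψ' w)) hPs.eventually_contDiffAt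
    (by rw [show P 0 = 0 from hη0]; exact hσs.contDiffAt)
    (by rw [show P 0 = 0 from hη0]; simp [hψ'0, hξφ])
    (by rwa [show P 0 = 0 from hη0])
  rw [show P 0 = 0 from hη0] at hr0 hrs hPr hri
  refine ⟨n, k, φ, ξ, η, r, hφ, rfl, hξφ, hξ 0, hφξ 0, hη0, hη, hr0, hrs, ?_, ?_,
    hri.mono fun q hq hq' => hq (congrArg η hq')⟩
  · -- `P (r z) = z.1` is an identity in the chart `η`; it holds in `Y` where `θ ∘ η = id`.
    have hrt : Tendsto r (𝓝 (0, 0)) (𝓝 0) := by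
      have := hrs.self_of_nhds.continuousAt.tendsto
      rwa [hr0] at this
    have hpr : Tendsto (fun z => p (φ (r z))) (𝓝 (0, 0)) (dnhds (p (φ 0))) :=
      (hp.smooth.tendsto_dnhds _).comp ((hφ.tendsto_dnhds 0).comp hrt)
    have hq : Tendsto (fun q : Y × EuclideanSpace ℝ (Fin n) => (η q.1, q.2))
        (dnhds (p (φ 0)) ×ˢ 𝓝 0) (𝓝 (0, 0)) := by
      rw [nhds_prod_eq]
      exact (hη.tendsto_of_eq hη0).prodMap tendsto_id
    filter_upwards [hq.eventually hPr, hq.eventually (hpr.eventually hθη),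
      tendsto_fst.eventually hθη] with q h1 h2 h3
    rw [← h2, ← h3]
    exact congrArg θ (by simpa [h3] using h1)
  · filter_upwards [hφξ 0, ((hξ 0).tendsto_of_eq (hξφ 0)).eventually hrP] with x' h1 h2
    simp only [hP, h1] at h2
    exact h2

end Manifolds

/-! ### Products near the units of a local groupoid -/

section Products

variable {G X : Type u} {s t : G → X} {D : Set (Composable s t)} {m : D → G}

theorem IsProd.unique {g h k l : G} (hk : IsProd m g h k) (hl : IsProd m g h l) : k = l := by
  obtain ⟨p, hp, rfl⟩ := hk
  obtain ⟨q, hq, rfl⟩ := hl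
  rw [Subtype.ext (Subtype.ext (hp.trans hq.symm))]

theorem IsProd.source_eq_target {g h k : G} (hk : IsProd m g h k) : s g = t h := by
  obtain ⟨p, hp, -⟩ := hk
  have := p.1.2
  rwa [hp] at this

end Products

namespace LocalQUEDGroupoid

variable {G X K Z : Type u} [DiffeologicalSpace G] [DiffeologicalSpace X]
  [DiffeologicalSpace K] [DiffeologicalSpace Z]

open Classical in
/-- The product `g h`, with the junk value `g` when it is not defined. -/
noncomputable def op (𝒢 : LocalQUEDGroupoid G X) (g h : G) : G :=
  if H : ∃ l, IsProd 𝒢.mul g h l then H.choose else g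

theorem op_eq (𝒢 : LocalQUEDGroupoid G X) {g h l : G} (hl : IsProd 𝒢.mul g h l) :
    𝒢.op g h = l := by
  have H : ∃ l, IsProd 𝒢.mul g h l := ⟨l, hl⟩
  rw [op, dif_pos H]
  exact H.choose_spec.unique hl

theorem isProd_unit_unit (𝒢 : LocalQUEDGroupoid G X) (x : X) :
    IsProd 𝒢.mul (𝒢.unit x) (𝒢.unit x) (𝒢.unit x) := by
  have h : IsProd 𝒢.mul (𝒢.unit x) (𝒢.unit x) (𝒢.mul ⟨_, 𝒢.unit_mem_mulDomain x⟩) :=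
    ⟨⟨_, 𝒢.unit_mem_mulDomain x⟩, rfl, rfl⟩
  have h' := 𝒢.unit_mul (𝒢.unit x) _ (by rw [𝒢.target_unit]; exact h)
  rwa [h'] at h

theorem tendsto_unit (𝒢 : LocalQUEDGroupoid G X) (x : X) :
    Tendsto 𝒢.unit (dnhds x) (dnhds (𝒢.unit x)) :=
  𝒢.unit_smooth.tendsto_dnhds x

theorem source_smooth (𝒢 : LocalQUEDGroupoid G X) : DSmooth 𝒢.source :=
  𝒢.source_submersion.localSubduction.smooth

theorem target_smooth (𝒢 : LocalQUEDGroupoid G X) : DSmooth 𝒢.target :=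
  𝒢.target_submersion.localSubduction.smooth

theorem tendsto_source (𝒢 : LocalQUEDGroupoid G X) (x : X) :
    Tendsto 𝒢.source (dnhds (𝒢.unit x)) (dnhds x) := by
  have := 𝒢.source_smooth.tendsto_dnhds (𝒢.unit x)
  rwa [𝒢.source_unit] at this

theorem tendsto_target (𝒢 : LocalQUEDGroupoid G X) (x : X) :
    Tendsto 𝒢.target (dnhds (𝒢.unit x)) (dnhds x) := by
  have := 𝒢.target_smooth.tendsto_dnhds (𝒢.unit x)
  rwa [𝒢.target_unit] at this

theorem tendsto_unit_source (𝒢 : LocalQUEDGroupoid G X) (x : X) :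
    Tendsto (fun g => 𝒢.unit (𝒢.source g)) (dnhds (𝒢.unit x)) (dnhds (𝒢.unit x)) :=
  (𝒢.tendsto_unit x).comp (𝒢.tendsto_source x)

theorem tendsto_unit_target (𝒢 : LocalQUEDGroupoid G X) (x : X) :
    Tendsto (fun g => 𝒢.unit (𝒢.target g)) (dnhds (𝒢.unit x)) (dnhds (𝒢.unit x)) :=
  (𝒢.tendsto_unit x).comp (𝒢.tendsto_target x)

/-- If two maps that are smooth near `z` are composable near `z`, and their product is defined at
`z`, then it is defined and smooth near `z`. -/
theorem smoothNear_op (𝒢 : LocalQUEDGroupoid G X) {W : Type*} [DiffeologicalSpace W]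
    {a b : W → G} {z : W} (ha : SmoothNear a z) (hb : SmoothNear b z)
    (hab : ∀ᶠ w in dnhds z, 𝒢.source (a w) = 𝒢.target (b w))
    (hz : ∃ l, IsProd 𝒢.mul (a z) (b z) l) :
    (∀ᶠ w in dnhds z, IsProd 𝒢.mul (a w) (b w) (𝒢.op (a w) (b w))) ∧
      SmoothNear (fun w => 𝒢.op (a w) (b w)) z := by
  classical
  obtain ⟨l, ⟨p, hp, -⟩⟩ := hz
  set c : W → Composable 𝒢.source 𝒢.target := fun w =>
    if h : 𝒢.source (a w) = 𝒢.target (b w) then ⟨(a w, b w), h⟩ else p.1 with hc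
  have hcz : c z = p.1 := by
    have : 𝒢.source (a z) = 𝒢.target (b z) := self_of_dnhds (p := fun w => 𝒢.source (a w) = 𝒢.target (b w)) hab
    simp only [hc, this, dif_pos]
    exact Subtype.ext hp.symm
  have hcs : SmoothNear c z := by
    obtain ⟨U, hU, hzU, hUs⟩ := ha
    obtain ⟨V, hV, hzV, hVs⟩ := hb
    obtain ⟨O, hOs, hO, hzO⟩ := mem_dnhds_iff.1 hab
    refine ⟨U ∩ V ∩ O, (hU.inter hV).inter hO, ⟨⟨hzU, hzV⟩, hzO⟩,
      dSmooth_restrict_iff.2 fun n q hq hm => ?_⟩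
    have h1 := dSmooth_restrict_iff.1 hUs n q hq fun i => (hm i).1.1
    have h2 := dSmooth_restrict_iff.1 hVs n q hq fun i => (hm i).1.2
    have h3 : (fun i => ((c ∘ q) i).1) = fun i => (a (q i), b (q i)) := funext fun i => by
      have : 𝒢.source (a (q i)) = 𝒢.target (b (q i)) := hOs (hm i).2
      simp [hc, this]
    change IsPlot (fun i => ((c ∘ q) i).1)
    rw [h3]
    exact ⟨h1, h2⟩
  set μ : Composable 𝒢.source 𝒢.target → G := fun q =>
    if h : q ∈ 𝒢.mulDomain then 𝒢.mul ⟨q, h⟩ else q.1.1 with hμ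
  have hμs : SmoothNear μ p.1 := by
    refine ⟨𝒢.mulDomain, 𝒢.mulDomain_open, p.2, ?_⟩
    have : (fun q : 𝒢.mulDomain => μ q) = 𝒢.mul := funext fun q => by simp [hμ]
    rw [this]
    exact 𝒢.mul_smooth
  have hprod : ∀ᶠ w in dnhds z, IsProd 𝒢.mul (a w) (b w) (μ (c w)) := by
    filter_upwards [hab, (hcs.tendsto_of_eq hcz).eventually
      (𝒢.mulDomain_open.mem_dnhds p.2)] with w h1 h2
    have h2' : c w ∈ 𝒢.mulDomain := h2
    exact ⟨⟨c w, h2'⟩, by simp [hc, h1], by simp [hμ, h2']⟩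
  have heq : ∀ᶠ w in dnhds z, μ (c w) = 𝒢.op (a w) (b w) :=
    hprod.mono fun w hw => (𝒢.op_eq hw).symm
  refine ⟨?_, (SmoothNear.comp_of_eq hμs hcs hcz).congr heq⟩
  filter_upwards [hprod, heq] with w h1 h2
  rwa [← h2]

/-- The pointwise product of two plots is a plot. -/
theorem isPlot_op (𝒢 : LocalQUEDGroupoid G X) {n : ℕ} {a b c : EuclideanSpace ℝ (Fin n) → G}
    (ha : IsPlot a) (hb : IsPlot b) (hc : ∀ z, IsProd 𝒢.mul (a z) (b z) (c z)) : IsPlot c := by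
  have h : c = fun z => 𝒢.op (a z) (b z) := funext fun z => (𝒢.op_eq (hc z)).symm
  rw [h]
  exact SmoothNear.isPlot fun z => (𝒢.smoothNear_op (ha.dSmooth.smoothNear z)
    (hb.dSmooth.smoothNear z) (Eventually.of_forall fun w => (hc w).source_eq_target)
    ⟨_, hc z⟩).2

/-- In a local Lie groupoid, the composable pairs close to a pair of units are parametrized by
plots. Hence the D-topology of the space of composable pairs is, at the units, the one
induced from the product of the D-topologies. -/
theorem exists_plots_composable {𝒢 : LocalQUEDGroupoid G X} (h𝒢 : 𝒢.IsLie) (x : X) :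
    ∃ (m : ℕ) (a b : EuclideanSpace ℝ (Fin m) → G), SmoothNear a 0 ∧ SmoothNear b 0 ∧
      a 0 = 𝒢.unit x ∧ b 0 = 𝒢.unit x ∧ (∀ᶠ z in 𝓝 0, 𝒢.source (a z) = 𝒢.target (b z)) ∧
      ∀ S ∈ 𝓝 (0 : EuclideanSpace ℝ (Fin m)),
        ∀ᶠ p in dnhds (𝒢.unit x) ×ˢ dnhds (𝒢.unit x), 𝒢.source p.1 = 𝒢.target p.2 →
          ∃ z ∈ S, a z = p.1 ∧ b z = p.2 := by
  obtain ⟨n, k, φ, ξ, η, r, hφ, hφ0, hξφ, hξ, hφξ, hη0, hη, hr0, hrs, hpr, hrp, -⟩ :=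
    𝒢.target_submersion.localSubduction.exists_fiber_retraction h𝒢.1 h𝒢.2 (𝒢.unit x)
  rw [𝒢.target_unit] at hη0 hη hpr
  have hξ0 : ξ (𝒢.unit x) = 0 := by rw [← hφ0, hξφ]
  let L : EuclideanSpace ℝ (Fin (n + n)) ≃L[ℝ]
      (EuclideanSpace ℝ (Fin n) × EuclideanSpace ℝ (Fin n)) :=
    ContinuousLinearEquiv.ofFinrankEq (by simp)
  -- The first arrow `φ v` is arbitrary; the second one is moved to the fiber over its source.
  set S : EuclideanSpace ℝ (Fin n) → EuclideanSpace ℝ (Fin k) := fun v => η (𝒢.source (φ v)) with hS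
  have hsφ : SmoothNear (fun v => 𝒢.source (φ v)) 0 :=
    (𝒢.source_smooth.comp hφ.dSmooth).smoothNear 0
  have hsφ0 : 𝒢.source (φ 0) = x := by rw [hφ0, 𝒢.source_unit]
  have hSs : SmoothNear S 0 := SmoothNear.comp_of_eq hη hsφ hsφ0
  have hS0 : S 0 = 0 := by simp [hS, hsφ0, hη0]
  have hL1 : Tendsto (fun z => (L z).1) (𝓝 0) (𝓝 0) := by
    have : Continuous fun z => (L z).1 := continuous_fst.comp L.continuous
    simpa using this.tendsto 0
  have hL2 : Tendsto (fun z => (L z).2) (𝓝 0) (𝓝 0) := by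
    have : Continuous fun z => (L z).2 := continuous_snd.comp L.continuous
    simpa using this.tendsto 0
  have hL1s : ContDiff ℝ ∞ fun z => (L z).1 := contDiff_fst.comp L.contDiff
  have hL2s : ContDiff ℝ ∞ fun z => (L z).2 := contDiff_snd.comp L.contDiff
  set f : EuclideanSpace ℝ (Fin (n + n)) →
      EuclideanSpace ℝ (Fin k) × EuclideanSpace ℝ (Fin n) :=
    fun z => (S (L z).1, (L z).2) with hf
  have hSt : Tendsto S (𝓝 0) (𝓝 0) := hSs.tendsto_of_eq hS0
  have hft : Tendsto f (𝓝 0) (𝓝 (0, 0)) := by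
    rw [nhds_prod_eq]
    exact (hSt.comp hL1).prodMk hL2
  have hfs : ∀ᶠ z in 𝓝 0, ContDiffAt ℝ ∞ f z :=
    (hL1.eventually hSs.eventually_contDiffAt).mono fun z hz =>
      (ContDiffAt.comp z (g := S) hz hL1s.contDiffAt).prodMk hL2s.contDiffAt
  have hrf : SmoothNear (fun z => r (f z)) 0 := smoothNear_of_contDiffAt <| by
    filter_upwards [hfs, hft.eventually hrs] with z h1 h2
    exact h2.comp z h1
  have hrf0 : r (f 0) = 0 := by simp [hf, hS0, hr0]
  refine ⟨n + n, fun z => φ (L z).1, fun z => φ (r (f z)),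
    (isPlot_reparam hφ hL1s).dSmooth.smoothNear 0,
    (hφ.dSmooth.smoothNear _).comp hrf, by simp [hφ0], by simp [hrf0, hφ0], ?_, ?_⟩
  · have h1 : Tendsto (fun z => (𝒢.source (φ (L z).1), (L z).2)) (𝓝 0) (dnhds x ×ˢ 𝓝 0) :=
      ((hsφ.tendsto_of_eq hsφ0).comp hL1).prodMk hL2
    filter_upwards [h1.eventually hpr] with z hz
    exact hz.symm
  · intro T hT
    have hξt : Tendsto ξ (dnhds (𝒢.unit x)) (𝓝 0) := hξ.tendsto_of_eq hξ0
    have h1 : Tendsto (fun p : G × G => L.symm (ξ p.1, ξ p.2))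
        (dnhds (𝒢.unit x) ×ˢ dnhds (𝒢.unit x)) (𝓝 0) := by
      have h2 : Tendsto L.symm (𝓝 (0, 0)) (𝓝 0) := by
        have := L.symm.continuous.tendsto 0
        rwa [map_zero] at this
      refine h2.comp ?_
      rw [nhds_prod_eq]
      exact hξt.prodMap hξt
    filter_upwards [h1.eventually hT, tendsto_fst.eventually hφξ, tendsto_snd.eventually hφξ,
      tendsto_snd.eventually hrp] with p h2 h3 h4 h5 h6
    refine ⟨_, h2, by simp [h3], ?_⟩
    simp only [hf, hS, ContinuousLinearEquiv.apply_symm_apply, h3, h6, h5, h4]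

/-- Let `Φ` be smooth near the unit at `x`, and take composable pairs close to that unit to
composable pairs of `𝒦`. Then the products `Φ g * Φ h` are defined for `g` and `h` close to the
unit, and are themselves close to a unit. -/
theorem eventually_exists_isProd {𝒢 : LocalQUEDGroupoid G X} (h𝒢 : 𝒢.IsLie)
    {𝒦 : LocalQUEDGroupoid K Z} {Φ : G → K} {x : X} {y : Z} (hΦ : SmoothNear Φ (𝒢.unit x))
    (hΦx : Φ (𝒢.unit x) = 𝒦.unit y)
    (hc : ∀ᶠ p in dnhds (𝒢.unit x) ×ˢ dnhds (𝒢.unit x), 𝒢.source p.1 = 𝒢.target p.2 →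
      𝒦.source (Φ p.1) = 𝒦.target (Φ p.2)) {O : Set K} (hO : O ∈ dnhds (𝒦.unit y)) :
    ∀ᶠ p in dnhds (𝒢.unit x) ×ˢ dnhds (𝒢.unit x), 𝒢.source p.1 = 𝒢.target p.2 →
      ∃ l ∈ O, IsProd 𝒦.mul (Φ p.1) (Φ p.2) l := by
  obtain ⟨m, a, b, ha, hb, ha0, hb0, hab, hsurj⟩ := exists_plots_composable h𝒢 x
  have hpair : Tendsto (fun z => (a z, b z)) (𝓝 0) (dnhds (𝒢.unit x) ×ˢ dnhds (𝒢.unit x)) :=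
    (ha.tendsto_of_eq ha0).prodMk (hb.tendsto_of_eq hb0)
  have h0 : IsProd 𝒦.mul (Φ (a 0)) (Φ (b 0)) (𝒦.unit y) := by
    rw [ha0, hb0, hΦx]
    exact 𝒦.isProd_unit_unit y
  have hcab : ∀ᶠ z in dnhds (0 : EuclideanSpace ℝ (Fin m)),
      𝒦.source (Φ (a z)) = 𝒦.target (Φ (b z)) := by
    filter_upwards [hab, hpair.eventually hc] with z h1 h2 using h2 h1
  obtain ⟨h1, h2⟩ := 𝒦.smoothNear_op (SmoothNear.comp_of_eq hΦ ha ha0)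
    (SmoothNear.comp_of_eq hΦ hb hb0) hcab ⟨_, h0⟩
  have h3 := (h2.tendsto_of_eq (𝒦.op_eq h0)).eventually hO
  filter_upwards [hsurj _ (h1.and h3)] with p hp hcomp
  obtain ⟨z, hz, hz1, hz2⟩ := hp hcomp
  rw [← hz1, ← hz2]
  exact ⟨_, hz.2, hz.1⟩

theorem eventually_exists_mul {𝒢 : LocalQUEDGroupoid G X} (h𝒢 : 𝒢.IsLie) {x : X} {O : Set G}
    (hO : O ∈ dnhds (𝒢.unit x)) :
    ∀ᶠ p in dnhds (𝒢.unit x) ×ˢ dnhds (𝒢.unit x), 𝒢.source p.1 = 𝒢.target p.2 →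
      ∃ l ∈ O, IsProd 𝒢.mul p.1 p.2 l :=
  eventually_exists_isProd h𝒢 (Φ := id) (dSmooth_id.smoothNear _) rfl
    (Eventually.of_forall fun _ h => h) hO

/-- An arrow close to a unit is joined to the unit at its source by a smooth path inside its source
fiber, which stays close to that unit. -/
theorem eventually_exists_path {𝒢 : LocalQUEDGroupoid G X} (h𝒢 : 𝒢.IsLie) {x : X} {O : Set G}
    (hO : O ∈ dnhds (𝒢.unit x)) :
    ∀ᶠ g in dnhds (𝒢.unit x), ∃ c : EuclideanSpace ℝ (Fin 1) → G, IsPlot c ∧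
      (∀ z, c z ∈ O) ∧ (∀ z, 𝒢.source (c z) = 𝒢.source g) ∧
      (∃ z, c z = 𝒢.unit (𝒢.source g)) ∧ ∃ z, c z = g := by
  obtain ⟨n, k, φ, ξ, η, r, hφ, hφ0, hξφ, hξ, hφξ, hη0, hη, hr0, hrs, hpr, hrp, -⟩ :=
    𝒢.source_submersion.localSubduction.exists_fiber_retraction h𝒢.1 h𝒢.2 (𝒢.unit x)
  rw [𝒢.source_unit] at hη0 hη hpr
  have hξ0 : ξ (𝒢.unit x) = 0 := by rw [← hφ0, hξφ]
  have hrt : Tendsto r (𝓝 (0, 0)) (𝓝 0) := by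
    have := hrs.self_of_nhds.continuousAt.tendsto
    rwa [hr0] at this
  have hφt : Tendsto φ (𝓝 0) (dnhds (𝒢.unit x)) := by
    have := hφ.tendsto_dnhds 0
    rwa [hφ0] at this
  have hgood : ∀ᶠ z in 𝓝 (0, 0), ContDiffAt ℝ ∞ r z ∧ φ (r z) ∈ O :=
    hrs.and ((hφt.comp hrt).eventually hO)
  rw [nhds_prod_eq] at hgood
  obtain ⟨A, hA, B, hB, hAB⟩ := mem_prod_iff.1 hgood
  obtain ⟨C, hC, D, hD, hCD⟩ := mem_prod_iff.1 hpr
  obtain ⟨ε, hε, hεB⟩ := Metric.mem_nhds_iff.1 (inter_mem hB hD)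
  have hgt : Tendsto (fun g => η (𝒢.source g)) (dnhds (𝒢.unit x)) (𝓝 0) :=
    (hη.tendsto_of_eq hη0).comp (𝒢.tendsto_source x)
  have hξt : Tendsto ξ (dnhds (𝒢.unit x)) (𝓝 0) := hξ.tendsto_of_eq hξ0
  have hut := 𝒢.tendsto_unit_source x
  have hball : Metric.ball 0 ε ∈ 𝓝 (0 : EuclideanSpace ℝ (Fin n)) := Metric.ball_mem_nhds 0 hε
  filter_upwards [hgt.eventually hA, (𝒢.tendsto_source x).eventually hC, hξt.eventually hball,
    hut.eventually (hξt.eventually hball), hφξ, hut.eventually hφξ, hrp,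
    hut.eventually hrp] with g h1 h2 h3 h4 h5 h6 h7 h8
  rw [𝒢.source_unit] at h8
  set v₀ := ξ (𝒢.unit (𝒢.source g))
  set v₁ := ξ g
  -- The straight path from `v₀` to `v₁` in the chart, moved to the fiber.
  set ℓ : EuclideanSpace ℝ (Fin 1) → EuclideanSpace ℝ (Fin n) :=
    fun z => v₀ + Real.smoothTransition (z 0) • (v₁ - v₀) with hℓ
  have hℓs : ContDiff ℝ ∞ ℓ := by
    have h : ContDiff ℝ ∞ fun z : EuclideanSpace ℝ (Fin 1) => Real.smoothTransition (z 0) :=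
      Real.smoothTransition.contDiff.comp (by fun_prop)
    exact contDiff_const.add (h.smul contDiff_const)
  have hℓball : ∀ z, ℓ z ∈ Metric.ball (0 : EuclideanSpace ℝ (Fin n)) ε := fun z =>
    (convex_ball _ _).add_smul_sub_mem h4 h3
      ⟨Real.smoothTransition.nonneg _, Real.smoothTransition.le_one _⟩
  refine ⟨fun z => φ (r (η (𝒢.source g), ℓ z)), ?_, fun z => ?_, fun z => ?_, ⟨0, ?_⟩,
    ⟨WithLp.toLp 2 fun _ => 1, ?_⟩⟩
  · refine isPlot_reparam hφ (f := fun z => r (η (𝒢.source g), ℓ z)) ?_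
    refine contDiff_iff_contDiffAt.2 fun z => ?_
    have hz : (η (𝒢.source g), ℓ z) ∈ A ×ˢ B := ⟨h1, (hεB (hℓball z)).1⟩
    exact (hAB hz).1.comp z (contDiffAt_const.prodMk hℓs.contDiffAt)
  · have hz : (η (𝒢.source g), ℓ z) ∈ A ×ˢ B := ⟨h1, (hεB (hℓball z)).1⟩
    exact (hAB hz).2
  · have hz : (𝒢.source g, ℓ z) ∈ C ×ˢ D := ⟨h2, (hεB (hℓball z)).2⟩
    exact hCD hz
  · have : ℓ 0 = v₀ := by simp [hℓ]
    simp only [this, h8, h6]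
  · have : ℓ (WithLp.toLp 2 fun _ => 1) = v₁ := by simp [hℓ]
    simp only [this, h7, h5]

end LocalQUEDGroupoid

/-! ### Inverses near the units of a local Lie groupoid -/

namespace LocalQUEDGroupoid

variable {G X : Type u} [DiffeologicalSpace G] [DiffeologicalSpace X]

/-- Arrows near a unit of a local Lie groupoid have left inverses, by the inverse function theorem.

The structure map `inv` cannot be used here: its products with the given arrow need not be defined,
not even at the units. -/
theorem exists_left_inv {𝒢 : LocalQUEDGroupoid G X} (h𝒢 : 𝒢.IsLie) (x : X) :
    ∃ ι : G → G, SmoothNear ι (𝒢.unit x) ∧ ι (𝒢.unit x) = 𝒢.unit x ∧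
      ∀ᶠ g in dnhds (𝒢.unit x), IsProd 𝒢.mul (ι g) g (𝒢.unit (𝒢.source g)) := by
  have htop : (∞ : WithTop ℕ∞) ≠ 0 := by simp
  obtain ⟨n, k, φ, ξ, η, r, hφ, hφ0, hξφ, hξ, hφξ, hη0, hη, hr0, hrs, hpr, -, hri⟩ :=
    𝒢.source_submersion.localSubduction.exists_fiber_retraction h𝒢.1 h𝒢.2 (𝒢.unit x)
  rw [𝒢.source_unit] at hη0 hη hpr
  have hξ0 : ξ (𝒢.unit x) = 0 := by rw [← hφ0, hξφ]
  let L : EuclideanSpace ℝ (Fin (n + n)) ≃L[ℝ]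
      (EuclideanSpace ℝ (Fin n) × EuclideanSpace ℝ (Fin n)) :=
    ContinuousLinearEquiv.ofFinrankEq (by simp)
  have hLt : Tendsto L (𝓝 0) (𝓝 (0, 0)) := by
    have := L.continuous.tendsto 0
    rwa [map_zero] at this
  have hLt' : Tendsto L.symm (𝓝 (0, 0)) (𝓝 0) := by
    have := L.symm.continuous.tendsto 0
    rwa [map_zero] at this
  have hL0 : L 0 = (0, 0) := map_zero L
  have hξt : Tendsto ξ (dnhds (𝒢.unit x)) (𝓝 0) := hξ.tendsto_of_eq hξ0
  -- `d (w, v)` is an arrow whose source is the target of `φ w`.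
  have htφ : SmoothNear (fun w => 𝒢.target (φ w)) 0 :=
    (𝒢.target_smooth.comp hφ.dSmooth).smoothNear 0
  have htφ0 : 𝒢.target (φ 0) = x := by rw [hφ0, 𝒢.target_unit]
  set T : EuclideanSpace ℝ (Fin n) → EuclideanSpace ℝ (Fin k) := fun w => η (𝒢.target (φ w))
    with hT
  have hTs : SmoothNear T 0 := SmoothNear.comp_of_eq hη htφ htφ0
  have hT0 : T 0 = 0 := by simp only [hT, htφ0, hη0]
  have hTt : Tendsto T (𝓝 0) (𝓝 0) := hTs.tendsto_of_eq hT0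
  set ρ : EuclideanSpace ℝ (Fin n) × EuclideanSpace ℝ (Fin n) → EuclideanSpace ℝ (Fin n) :=
    fun z => r (T z.1, z.2) with hρ
  have hTz : Tendsto (fun z : EuclideanSpace ℝ (Fin n) × EuclideanSpace ℝ (Fin n) =>
      (T z.1, z.2)) (𝓝 (0, 0)) (𝓝 (0, 0)) := by
    rw [nhds_prod_eq, nhds_prod_eq]
    exact hTt.prodMap tendsto_id
  have hρs : ∀ᶠ z in 𝓝 (0, 0), ContDiffAt ℝ ∞ ρ z := by
    have h1 : Tendsto (fun z : EuclideanSpace ℝ (Fin n) × EuclideanSpace ℝ (Fin n) => z.1)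
        (𝓝 (0, 0)) (𝓝 0) := continuous_fst.tendsto _
    filter_upwards [h1.eventually hTs.eventually_contDiffAt, hTz.eventually hrs] with z h2 h3
    exact ContDiffAt.comp z h3
      ((ContDiffAt.comp z (g := T) h2 contDiffAt_fst).prodMk contDiffAt_snd)
  have hρ0 : ρ (0, 0) = 0 := by simp only [hρ, hT0, hr0]
  have hρL : SmoothNear (fun z => ρ (L z)) 0 := smoothNear_of_contDiffAt <|
    (hLt.eventually hρs).mono fun z hz => ContDiffAt.comp z (g := ρ) hz L.contDiff.contDiffAt
  have hLfst : ContDiff ℝ ∞ fun z => (L z).1 := contDiff_fst.comp L.contDiff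
  have hds : SmoothNear (fun z => φ (ρ (L z))) 0 :=
    SmoothNear.comp_of_eq (hφ.dSmooth.smoothNear 0) hρL (by simp only [hL0, hρ0])
  have hφL : SmoothNear (fun z => φ (L z).1) 0 :=
    (isPlot_reparam hφ hLfst).dSmooth.smoothNear 0
  have hsd : ∀ᶠ z in 𝓝 (0, 0), 𝒢.source (φ (ρ z)) = 𝒢.target (φ z.1) := by
    have h1 : Tendsto (fun z : EuclideanSpace ℝ (Fin n) × EuclideanSpace ℝ (Fin n) =>
        (𝒢.target (φ z.1), z.2)) (𝓝 (0, 0)) (dnhds x ×ˢ 𝓝 0) := by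
      rw [nhds_prod_eq]
      exact (htφ.tendsto_of_eq htφ0).prodMap tendsto_id
    exact h1.eventually hpr
  have hprod0 : IsProd 𝒢.mul (φ (ρ (L 0))) (φ (L 0).1) (𝒢.unit x) := by
    simp only [hL0, hρ0, hφ0]
    exact 𝒢.isProd_unit_unit x
  obtain ⟨hprodL, hopL⟩ := 𝒢.smoothNear_op hds hφL (hLt.eventually hsd) ⟨_, hprod0⟩
  set μ : EuclideanSpace ℝ (Fin n) × EuclideanSpace ℝ (Fin n) → G :=
    fun z => 𝒢.op (φ (ρ z)) (φ z.1) with hμ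
  have hprod : ∀ᶠ z in 𝓝 (0, 0), IsProd 𝒢.mul (φ (ρ z)) (φ z.1) (μ z) := by
    filter_upwards [hLt'.eventually hprodL] with z hz
    simpa using hz
  have hμt : Tendsto μ (𝓝 (0, 0)) (dnhds (𝒢.unit x)) := by
    have h1 := (hopL.tendsto_of_eq (𝒢.op_eq hprod0)).comp hLt'
    refine h1.congr fun z => ?_
    simp [hμ]
  have hξμ : ∀ᶠ z in 𝓝 (0, 0), ContDiffAt ℝ ∞ (fun z => ξ (μ z)) z := by
    have h1 : SmoothNear (fun z => ξ (μ (L z))) 0 :=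
      SmoothNear.comp_of_eq hξ hopL (𝒢.op_eq hprod0)
    filter_upwards [hLt'.eventually h1.eventually_contDiffAt] with z hz
    have h2 := ContDiffAt.comp z hz L.symm.contDiff.contDiffAt
    refine h2.congr_of_eventuallyEq (Eventually.of_forall fun z => ?_)
    simp
  -- The product `d (w, v) * φ w`, corrected so as to be the identity in `v` when `w = 0`.
  set N : EuclideanSpace ℝ (Fin n) × EuclideanSpace ℝ (Fin n) → EuclideanSpace ℝ (Fin n) :=
    fun z => ξ (μ z) + (z.2 - ρ z) with hN
  have hNs : ∀ᶠ z in 𝓝 (0, 0), ContDiffAt ℝ ∞ N z := by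
    filter_upwards [hξμ, hρs] with z h1 h2 using h1.add (contDiffAt_snd.sub h2)
  have hinr : Tendsto (fun v : EuclideanSpace ℝ (Fin n) => ((0 : EuclideanSpace ℝ (Fin n)), v))
      (𝓝 0) (𝓝 (0, 0)) := (Continuous.prodMk_right _).tendsto 0
  have hN0 : ∀ᶠ v in 𝓝 0, N (0, v) = v := by
    filter_upwards [hinr.eventually hprod, hinr.eventually hsd] with v h1 h2
    have h3 : μ (0, v) = φ (ρ (0, v)) := by
      refine 𝒢.mul_unit _ _ ?_
      rw [h2]
      simpa only [hφ0, 𝒢.target_unit] using h1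
    simp only [hN, h3, hξφ]
    abel
  have hN00 : N (0, 0) = 0 := hN0.self_of_nhds
  have hNd := (hNs.self_of_nhds.differentiableAt htop).hasFDerivAt
  have hNinr : (fderiv ℝ N (0, 0)).comp (ContinuousLinearMap.inr ℝ _ _) =
      ContinuousLinearMap.id ℝ (EuclideanSpace ℝ (Fin n)) := by
    have h1 : HasFDerivAt (fun v : EuclideanSpace ℝ (Fin n) => N (0, v))
        ((fderiv ℝ N (0, 0)).comp (ContinuousLinearMap.inr ℝ _ _)) 0 :=
      hNd.comp (0 : EuclideanSpace ℝ (Fin n)) (hasFDerivAt_prodMk_right 0 0)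
    exact h1.unique ((hasFDerivAt_id (𝕜 := ℝ) _).congr_of_eventuallyEq hN0)
  have hNd' : HasFDerivAt N (((fderiv ℝ N (0, 0)).comp (ContinuousLinearMap.inl ℝ _ _)).comp
      (ContinuousLinearMap.fst ℝ _ _) + ContinuousLinearMap.snd ℝ _ _) (0, 0) := by
    refine hNd.congr_fderiv (ContinuousLinearMap.ext fun z => ?_)
    have h1 := DFunLike.congr_fun hNinr z.2
    have h2 : z = (z.1, 0) + (0, z.2) := by simp
    simp only [ContinuousLinearMap.comp_apply, ContinuousLinearMap.inr_apply,
      ContinuousLinearMap.id_apply] at h1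
    conv_lhs => rw [h2, map_add, h1]
    simp
  obtain ⟨h, hh, hmem, hsymm⟩ := exists_openPartialHomeomorph_of_shear hNs hNd'
  rw [hN00] at hsymm
  have hx : h (0, 0) = (0, 0) := by rw [hh, hN00]
  have hmem' : ((0 : EuclideanSpace ℝ (Fin n)), (0 : EuclideanSpace ℝ (Fin n))) ∈ h.target :=
    hx ▸ h.map_source hmem
  have hsymm0 : h.symm (0, 0) = (0, 0) := by
    have := h.left_inv hmem
    rwa [hx] at this
  have hst : Tendsto h.symm (𝓝 (0, 0)) (𝓝 (0, 0)) := by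
    have := hsymm.self_of_nhds.continuousAt.tendsto
    rwa [hsymm0] at this
  -- Solve `N (w, v) = υ w` for `v`, where `υ w` represents the unit at the source of `φ w`.
  set υ : EuclideanSpace ℝ (Fin n) → EuclideanSpace ℝ (Fin n) :=
    fun w => ξ (𝒢.unit (𝒢.source (φ w))) with hυ
  have hu : SmoothNear (fun w => 𝒢.unit (𝒢.source (φ w))) 0 :=
    ((𝒢.unit_smooth.comp 𝒢.source_smooth).comp hφ.dSmooth).smoothNear 0
  have hu0 : 𝒢.unit (𝒢.source (φ 0)) = 𝒢.unit x := by rw [hφ0, 𝒢.source_unit]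
  have hυs : SmoothNear υ 0 := SmoothNear.comp_of_eq hξ hu hu0
  have hυ0 : υ 0 = 0 := by simp only [hυ, hu0, hξ0]
  have hυt : Tendsto (fun w => (υ w, w)) (𝓝 0) (𝓝 (0, 0)) := by
    rw [nhds_prod_eq]
    exact (hυs.tendsto_of_eq hυ0).prodMk tendsto_id
  set V : EuclideanSpace ℝ (Fin n) → EuclideanSpace ℝ (Fin n) × EuclideanSpace ℝ (Fin n) :=
    fun w => h.symm (υ w, w) with hV
  have hVt : Tendsto V (𝓝 0) (𝓝 (0, 0)) := hst.comp hυt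
  have hV0 : V 0 = (0, 0) := by simp only [hV, hυ0, hsymm0]
  have hVs : ∀ᶠ w in 𝓝 0, ContDiffAt ℝ ∞ V w := by
    filter_upwards [hυt.eventually hsymm, hυs.eventually_contDiffAt] with w h1 h2
    exact ContDiffAt.comp w h1 (h2.prodMk contDiffAt_id)
  have hρV : SmoothNear (fun w => ρ (V w)) 0 := smoothNear_of_contDiffAt <| by
    filter_upwards [hVs, hVt.eventually hρs] with w h1 h2 using ContDiffAt.comp w (g := ρ) h2 h1
  have hρV0 : ρ (V 0) = 0 := by rw [hV0, hρ0]
  have hι : SmoothNear (fun g => ρ (V (ξ g))) (𝒢.unit x) :=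
    SmoothNear.comp_of_eq (g := fun w => ρ (V w)) hρV hξ hξ0
  refine ⟨fun g => φ (ρ (V (ξ g))),
    SmoothNear.comp_of_eq (hφ.dSmooth.smoothNear 0) hι (by simp only [hξ0, hρV0]),
    by simp only [hξ0, hρV0, hφ0], ?_⟩
  have hW : Tendsto (fun w => (υ w, (T (V w).1, (V w).2))) (𝓝 0) (𝓝 0 ×ˢ 𝓝 (0, 0)) :=
    (hυs.tendsto_of_eq hυ0).prodMk (hTz.comp hVt)
  filter_upwards [hφξ, hξt.eventually (hVt.eventually hprod),
    hξt.eventually (hυt.eventually (h.open_target.mem_nhds hmem')),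
    hξt.eventually (hVt.eventually (hμt.eventually hφξ)), hξt.eventually (hW.eventually hri),
    hξt.eventually ((hu.tendsto_of_eq hu0).eventually hφξ)] with g h1 h2 h3 h4 h5 h6
  have h7 : h (V (ξ g)) = (υ (ξ g), ξ g) := h.right_inv h3
  rw [hh] at h7
  have h8 : (V (ξ g)).1 = ξ g := congrArg Prod.snd h7
  have h9 : ξ (μ (V (ξ g))) = υ (ξ g) + (ρ (V (ξ g)) - (V (ξ g)).2) := by
    have : ξ (μ (V (ξ g))) + ((V (ξ g)).2 - ρ (V (ξ g))) = υ (ξ g) := congrArg Prod.fst h7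
    rw [← this]
    abel
  rw [h8, h1] at h2
  have h10 : ρ (V (ξ g)) = (V (ξ g)).2 := by
    refine h5 ?_
    change 𝒢.source (φ (υ (ξ g) + (ρ (V (ξ g)) - (V (ξ g)).2))) = 𝒢.source (φ (υ (ξ g)))
    rw [← h9, h4, 𝒢.source_mul _ _ _ h2, h6, 𝒢.source_unit, h1]
  rw [h10, sub_self, add_zero] at h9
  have h11 : μ (V (ξ g)) = 𝒢.unit (𝒢.source g) := by
    rw [← h4, h9, h6, h1]
  rwa [h11] at h2

/-- Arrows near a unit of a local Lie groupoid have two-sided inverses. -/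
theorem exists_inv {𝒢 : LocalQUEDGroupoid G X} (h𝒢 : 𝒢.IsLie) (x : X) :
    ∃ ι : G → G, SmoothNear ι (𝒢.unit x) ∧ ι (𝒢.unit x) = 𝒢.unit x ∧
      (∀ᶠ g in dnhds (𝒢.unit x), IsProd 𝒢.mul (ι g) g (𝒢.unit (𝒢.source g))) ∧
      ∀ᶠ g in dnhds (𝒢.unit x), IsProd 𝒢.mul g (ι g) (𝒢.unit (𝒢.target g)) := by
  obtain ⟨ι, hι, hι0, hl⟩ := exists_left_inv h𝒢 x
  refine ⟨ι, hι, hι0, hl, ?_⟩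
  have hιt : Tendsto ι (dnhds (𝒢.unit x)) (dnhds (𝒢.unit x)) := hι.tendsto_of_eq hι0
  have hex := eventually_exists_mul h𝒢 (x := x) (O := Set.univ) univ_mem
  have hid : Tendsto (fun g : G => g) (dnhds (𝒢.unit x)) (dnhds (𝒢.unit x)) := tendsto_id
  -- An arrow is equal to the left inverse of its left inverse.
  filter_upwards [hl, hιt.eventually hl,
    ((𝒢.tendsto_unit_target x).prodMk hid).eventually hex,
    ((hιt.comp hιt).prodMk (𝒢.tendsto_unit_source x)).eventually hex] with g h1 h2 h4 h5
  have e1 : 𝒢.source (ι g) = 𝒢.target g := h1.source_eq_target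
  have e2 : 𝒢.target (ι g) = 𝒢.source g := by
    rw [← 𝒢.target_mul _ _ _ h1, 𝒢.target_unit]
  have e3 : 𝒢.source (ι (ι g)) = 𝒢.source g := by rw [h2.source_eq_target, e2]
  obtain ⟨k, -, hk⟩ := h4 (𝒢.source_unit _)
  have hk' := 𝒢.unit_mul _ _ hk
  obtain ⟨l, -, hl'⟩ := h5 (e3.trans (𝒢.target_unit _).symm)
  have hl'' : l = ι (ι g) := 𝒢.mul_unit _ _ (by rw [e3]; exact hl')
  rw [e1] at h2
  have h6 := 𝒢.mul_assoc _ _ _ _ _ _ _ h2 h1 hl' hk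
  rw [hl'', hk'] at h6
  rwa [h6] at h2

end LocalQUEDGroupoid

/-! ### Morphisms and lifts near a unit -/

namespace LocalQUEDGroupoid

section Morphisms

variable {A X B Y K Z : Type u} [DiffeologicalSpace A] [DiffeologicalSpace X]
  [DiffeologicalSpace B] [DiffeologicalSpace Y] [DiffeologicalSpace K] [DiffeologicalSpace Z]

/-- The map `Φ` behaves like a morphism of local groupoids covering `f` near the unit at `x`. In
contrast to `IsMorphismOn`, the products of arrows close to the unit, and those of their images,
are required to be defined. -/
structure IsMorphismNear (𝒜 : LocalQUEDGroupoid A X) (𝒦 : LocalQUEDGroupoid K Z) (f : X → Z)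
    (Φ : A → K) (x : X) : Prop where
  smooth : SmoothNear Φ (𝒜.unit x)
  map_unit : ∀ᶠ x' in dnhds x, Φ (𝒜.unit x') = 𝒦.unit (f x')
  source_map : ∀ᶠ g in dnhds (𝒜.unit x), 𝒦.source (Φ g) = f (𝒜.source g)
  target_map : ∀ᶠ g in dnhds (𝒜.unit x), 𝒦.target (Φ g) = f (𝒜.target g)
  map_mul : ∀ᶠ p in dnhds (𝒜.unit x) ×ˢ dnhds (𝒜.unit x), 𝒜.source p.1 = 𝒜.target p.2 →
    ∃ k, IsProd 𝒜.mul p.1 p.2 k ∧ IsProd 𝒦.mul (Φ p.1) (Φ p.2) (Φ k)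

theorem IsMorphismNear.apply_unit {𝒜 : LocalQUEDGroupoid A X} {𝒦 : LocalQUEDGroupoid K Z}
    {f : X → Z} {Φ : A → K} {x : X} (h : IsMorphismNear 𝒜 𝒦 f Φ x) :
    Φ (𝒜.unit x) = 𝒦.unit (f x) :=
  self_of_dnhds (p := fun x' => Φ (𝒜.unit x') = 𝒦.unit (f x')) h.map_unit

theorem IsMorphismNear.tendsto {𝒜 : LocalQUEDGroupoid A X} {𝒦 : LocalQUEDGroupoid K Z}
    {f : X → Z} {Φ : A → K} {x : X} (h : IsMorphismNear 𝒜 𝒦 f Φ x) :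
    Tendsto Φ (dnhds (𝒜.unit x)) (dnhds (𝒦.unit (f x))) :=
  h.smooth.tendsto_of_eq h.apply_unit

theorem IsMorphismOn.apply_unit {𝒜 : LocalQUEDGroupoid A X} {𝒦 : LocalQUEDGroupoid K Z}
    {f : X → Z} {Φ : A → K} {U : Set A} (hunit : Set.range 𝒜.unit ⊆ U)
    (h : IsMorphismOn 𝒜 𝒦 f Φ U) (x : X) : Φ (𝒜.unit x) = 𝒦.unit (f x) := by
  obtain ⟨z, hz⟩ := h.map_unit x
  have h1 := h.source_map _ (hunit ⟨x, rfl⟩)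
  rw [← hz, 𝒦.source_unit, 𝒜.source_unit] at h1
  rw [← hz, h1]

/-- Composition with a morphism; the identity of the first groupoid yields
`IsMorphismOn.isMorphismNear`. -/
theorem IsMorphismOn.comp_isMorphismNear {W C : Type u} [DiffeologicalSpace W]
    [DiffeologicalSpace C] {𝒜 : LocalQUEDGroupoid A X} {𝒦 : LocalQUEDGroupoid K Z}
    {𝒞 : LocalQUEDGroupoid C W} (h𝒜 : 𝒜.IsLie) {f : X → Z} {g : Z → W} {Φ : A → K} {Ψ : K → C}
    {U : Set K} (hU : DOpen U) (hunit : Set.range 𝒦.unit ⊆ U) (hΨ : IsMorphismOn 𝒦 𝒞 g Ψ U)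
    {x : X} (hΦ : IsMorphismNear 𝒜 𝒦 f Φ x) :
    IsMorphismNear 𝒜 𝒞 (g ∘ f) (Ψ ∘ Φ) x := by
  have hΨs : SmoothNear Ψ (𝒦.unit (f x)) := ⟨U, hU, hunit ⟨_, rfl⟩, hΨ.smooth⟩
  have hU' : ∀ᶠ k in dnhds (𝒦.unit (f x)), k ∈ U := hU.mem_dnhds (hunit ⟨_, rfl⟩)
  have hs : SmoothNear (Ψ ∘ Φ) (𝒜.unit x) := 
    SmoothNear.comp_of_eq (g := Ψ) hΨs hΦ.smooth hΦ.apply_unit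
  have hsrc : ∀ᶠ a in dnhds (𝒜.unit x), 𝒞.source (Ψ (Φ a)) = g (f (𝒜.source a)) := by
    filter_upwards [hΦ.tendsto.eventually hU', hΦ.source_map] with a h1 h2
    rw [hΨ.source_map _ h1, h2]
  have htgt : ∀ᶠ a in dnhds (𝒜.unit x), 𝒞.target (Ψ (Φ a)) = g (f (𝒜.target a)) := by
    filter_upwards [hΦ.tendsto.eventually hU', hΦ.target_map] with a h1 h2
    rw [hΨ.target_map _ h1, h2]
  refine ⟨hs, ?_, hsrc, htgt, ?_⟩
  · filter_upwards [hΦ.map_unit] with x' hx'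
    rw [Function.comp_apply, hx', hΨ.apply_unit hunit, Function.comp_apply]
  · have hdef := eventually_exists_isProd (𝒦 := 𝒞) h𝒜 hs
      (y := g (f x)) (by rw [Function.comp_apply, hΦ.apply_unit, hΨ.apply_unit hunit])
      (by
        filter_upwards [tendsto_fst.eventually hsrc, tendsto_snd.eventually htgt] with p h1 h2 h3
        rw [Function.comp_apply, Function.comp_apply, h1, h2, h3])
      (O := Set.univ) univ_mem
    have hΦU := hΦ.tendsto.eventually hU'
    filter_upwards [hΦ.map_mul, hdef, eventually_exists_mul h𝒜 hΦU,
      tendsto_fst.eventually hΦU, tendsto_snd.eventually hΦU] with p h1 h2 h3 h4 h5 hc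
    obtain ⟨k, hk, hk'⟩ := h1 hc
    obtain ⟨l, -, hl⟩ := h2 hc
    obtain ⟨k', hk'U, hk''⟩ := h3 hc
    obtain rfl := hk''.unique hk
    refine ⟨_, hk, ?_⟩
    have : Ψ (Φ k') = l := hΨ.map_mul _ h4 _ h5 _ hk'U _ hk' hl
    rw [Function.comp_apply (x := k'), this]
    exact hl

theorem isMorphismNear_id {𝒜 : LocalQUEDGroupoid A X} (h𝒜 : 𝒜.IsLie) (x : X) :
    IsMorphismNear 𝒜 𝒜 id id x where
  smooth := dSmooth_id.smoothNear _
  map_unit := Eventually.of_forall fun _ => rfl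
  source_map := Eventually.of_forall fun _ => rfl
  target_map := Eventually.of_forall fun _ => rfl
  map_mul := (eventually_exists_mul h𝒜 (O := Set.univ) univ_mem).mono fun p hp hc => by
    obtain ⟨k, -, hk⟩ := hp hc
    exact ⟨k, hk, hk⟩

theorem IsMorphismOn.isMorphismNear {𝒜 : LocalQUEDGroupoid A X} {𝒦 : LocalQUEDGroupoid K Z}
    (h𝒜 : 𝒜.IsLie) {f : X → Z} {Φ : A → K} {U : Set A} (hU : DOpen U)
    (hunit : Set.range 𝒜.unit ⊆ U) (hΦ : IsMorphismOn 𝒜 𝒦 f Φ U) (x : X) :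
    IsMorphismNear 𝒜 𝒦 f Φ x :=
  hΦ.comp_isMorphismNear h𝒜 hU hunit (isMorphismNear_id h𝒜 x)

theorem IsMorphismNear.congr {𝒜 : LocalQUEDGroupoid A X} {𝒦 : LocalQUEDGroupoid K Z}
    (h𝒜 : 𝒜.IsLie) {f : X → Z} {Φ Φ' : A → K} {x : X} (hΦ : IsMorphismNear 𝒜 𝒦 f Φ x)
    (h : Φ =ᶠ[dnhds (𝒜.unit x)] Φ') : IsMorphismNear 𝒜 𝒦 f Φ' x where
  smooth := hΦ.smooth.congr h
  map_unit := by
    filter_upwards [hΦ.map_unit, (𝒜.tendsto_unit x).eventually h] with x' h1 h2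
    rw [← h2, h1]
  source_map := by
    filter_upwards [hΦ.source_map, h] with g h1 h2
    rw [← h2, h1]
  target_map := by
    filter_upwards [hΦ.target_map, h] with g h1 h2
    rw [← h2, h1]
  map_mul := by
    filter_upwards [hΦ.map_mul, eventually_exists_mul h𝒜 h, tendsto_fst.eventually h,
      tendsto_snd.eventually h] with p h1 h2 h3 h4 hc
    obtain ⟨k, hk, hk'⟩ := h1 hc
    obtain ⟨k', hk'', hk3⟩ := h2 hc
    obtain rfl := hk3.unique hk
    have hk''' : Φ k' = Φ' k' := hk''
    exact ⟨k', hk, by rw [← h3, ← h4, ← hk''']; exact hk'⟩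

/-! ### Uniqueness of lifts of paths in source fibers -/

/-- Near a unit, a path in a source fiber of `ℬ` is determined by one of its values and its image
under `π`. Indeed, if `a` and `b` are two such paths, `b⁻¹ a` is a path in a single fiber of `π`,
hence constant. -/
theorem exists_nhds_forall_path_eq {ℬ : LocalQUEDGroupoid B Y} {𝒦 : LocalQUEDGroupoid K Z}
    (hℬ : ℬ.IsLie) {π : B → K} (hfib : ∀ k, IsTotDisconnected (π ⁻¹' {k})) {j : Y → Z}
    (hj : Function.Injective j) {y : Y} (hπ : IsMorphismNear ℬ 𝒦 j π y) :
    ∃ Ω ∈ dnhds (ℬ.unit y), ∀ a b : EuclideanSpace ℝ (Fin 1) → B, IsPlot a → IsPlot b →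
      (∀ z, a z ∈ Ω) → (∀ z, b z ∈ Ω) → (∀ z, π (a z) = π (b z)) →
      (∀ z w, ℬ.source (a z) = ℬ.source (a w)) → (∃ z, a z = b z) → ∀ z, a z = b z := by
  obtain ⟨ι, hι, hι0, hl, hr⟩ := exists_inv hℬ y
  have hιt : Tendsto ι (dnhds (ℬ.unit y)) (dnhds (ℬ.unit y)) := hι.tendsto_of_eq hι0
  have hid : Tendsto (fun g : B => g) (dnhds (ℬ.unit y)) (dnhds (ℬ.unit y)) := tendsto_id
  have hex := eventually_exists_mul hℬ (x := y) (O := Set.univ) univ_mem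
  have hgood := (((hιt.comp tendsto_snd).prodMk tendsto_fst).eventually hπ.map_mul).and
    (tendsto_snd.eventually (((hιt.prodMk hid).eventually hπ.map_mul).and
      (hι.eventually.and (hl.and (hr.and ((hid.prodMk (ℬ.tendsto_unit_source y)).eventually
      hex))))) |>.and (tendsto_fst.eventually
        ((((ℬ.tendsto_unit_target y).prodMk hid).eventually hex).and
          (hπ.source_map.and hπ.target_map))))
  obtain ⟨Ω, hΩ, hgood⟩ := mem_prod_self_iff.1 hgood
  refine ⟨Ω, hΩ, fun a b ha hb haΩ hbΩ hab hs ⟨z₀, hz₀⟩ => ?_⟩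
  have key := fun z w => hgood (Set.mk_mem_prod (haΩ z) (hbΩ w))
  have key' := fun z w => hgood (Set.mk_mem_prod (hbΩ z) (hbΩ w))
  simp only [Set.mem_ofPred_eq, Function.comp_apply] at key key'
  have hsab : ∀ z, ℬ.source (a z) = ℬ.source (b z) := fun z => hj <| by
    rw [← (key z z).2.2.2.1, ← (key' z z).2.2.2.1, hab]
  have htab : ∀ z, ℬ.target (a z) = ℬ.target (b z) := fun z => hj <| by
    rw [← (key z z).2.2.2.2, ← (key' z z).2.2.2.2, hab]
  have hl' : ∀ z, IsProd ℬ.mul (ι (b z)) (b z) (ℬ.unit (ℬ.source (b z))) :=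
    fun z => (key z z).2.1.2.2.1
  have hD : ∀ z, ∃ k, IsProd ℬ.mul (ι (b z)) (a z) k ∧
      IsProd 𝒦.mul (π (ι (b z))) (π (a z)) (π k) := fun z =>
    (key z z).1 ((hl' z).source_eq_target.trans (htab z).symm)
  choose D hD hπD using hD
  have hDs : IsPlot D := ℬ.isPlot_op (a := ι ∘ b) (b := a)
    (SmoothNear.isPlot_comp hb fun z => (key z z).2.1.2.1) ha hD
  have hs' : ∀ z w, ℬ.source (b z) = ℬ.source (b w) := fun z w => by
    rw [← hsab, ← hsab, hs z w]
  have hπD' : ∀ z, π (D z) = π (ℬ.unit (ℬ.source (b z₀))) := fun z => by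
    obtain ⟨k, hk, hk'⟩ := (key z z).2.1.1 (hl' z).source_eq_target
    obtain rfl := hk.unique (hl' z)
    rw [← hs' z z₀]
    have h1 := hπD z
    rw [hab z] at h1
    exact h1.unique hk'
  have hconst : ∀ z, D z = D z₀ := fun z => by
    have := (hfib (π (ℬ.unit (ℬ.source (b z₀)))) 1 (fun z => ⟨D z, hπD' z⟩)
      hDs).apply_eq_of_preconnectedSpace z z₀
    exact congrArg Subtype.val this
  intro z
  have h0 : D z = ℬ.unit (ℬ.source (b z)) := by
    rw [hconst z, hs' z z₀]
    have h1 := hD z₀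
    rw [hz₀] at h1
    exact h1.unique (hl' z₀)
  -- `b = b (b⁻¹ a) = (b b⁻¹) a = a`.
  have h1 := hD z
  rw [h0] at h1
  obtain ⟨-, ⟨-, -, -, hr', hbu⟩, hau, -⟩ := key z z
  obtain ⟨k, -, hk⟩ := hbu (ℬ.target_unit _).symm
  obtain ⟨l, -, hl⟩ := hau (ℬ.source_unit _)
  have hl2 := ℬ.unit_mul _ _ hl
  have hk2 := ℬ.mul_unit _ _ hk
  rw [htab z] at hl
  have := ℬ.mul_assoc _ _ _ _ _ _ _ hr' h1 hk hl
  rw [← hl2, ← hk2, this]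

end Morphisms

/-! ### Lifting morphisms near a unit -/

section Lifts

variable {A X B Y K Z : Type u} [DiffeologicalSpace A] [DiffeologicalSpace X]
  [DiffeologicalSpace B] [DiffeologicalSpace Y]

/-- The map `F` lifts `Φ` through `π` near the unit at `x`, and takes units to units. -/
structure IsLiftNear (𝒜 : LocalQUEDGroupoid A X) (ℬ : LocalQUEDGroupoid B Y) (π : B → K)
    (f : X → Y) (Φ : A → K) (F : A → B) (x : X) : Prop where
  smooth : SmoothNear F (𝒜.unit x)
  lift : ∀ᶠ g in dnhds (𝒜.unit x), π (F g) = Φ g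
  map_unit : ∀ᶠ x' in dnhds x, F (𝒜.unit x') = ℬ.unit (f x')

namespace IsLiftNear

variable {𝒜 : LocalQUEDGroupoid A X} {ℬ : LocalQUEDGroupoid B Y} {π : B → K} {f : X → Y}
  {Φ : A → K} {F F' : A → B} {x : X}

theorem apply_unit (h : IsLiftNear 𝒜 ℬ π f Φ F x) : F (𝒜.unit x) = ℬ.unit (f x) :=
  self_of_dnhds (p := fun x' => F (𝒜.unit x') = ℬ.unit (f x')) h.map_unit

theorem tendsto (h : IsLiftNear 𝒜 ℬ π f Φ F x) :
    Tendsto F (dnhds (𝒜.unit x)) (dnhds (ℬ.unit (f x))) :=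
  h.smooth.tendsto_of_eq h.apply_unit

theorem eventually (h : IsLiftNear 𝒜 ℬ π f Φ F x) :
    ∀ᶠ x' in dnhds x, IsLiftNear 𝒜 ℬ π f Φ F x' := by
  filter_upwards [(𝒜.tendsto_unit x).eventually h.smooth.eventually,
    (𝒜.tendsto_unit x).eventually (eventually_eventually_dnhds.2 h.lift),
    eventually_eventually_dnhds.2 h.map_unit] with x' h1 h2 h3
  exact ⟨h1, h2, h3⟩

theorem congr (h : IsLiftNear 𝒜 ℬ π f Φ F x) (hF : F =ᶠ[dnhds (𝒜.unit x)] F') :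
    IsLiftNear 𝒜 ℬ π f Φ F' x where
  smooth := h.smooth.congr hF
  lift := by
    filter_upwards [h.lift, hF] with g h1 h2
    rw [← h2, h1]
  map_unit := by
    filter_upwards [h.map_unit, (𝒜.tendsto_unit x).eventually hF] with x' h1 h2
    rw [← h2, h1]

variable [DiffeologicalSpace K] [DiffeologicalSpace Z] {𝒦 : LocalQUEDGroupoid K Z} {j : Y → Z}

theorem source_map (hj : Function.Injective j) (hπ : IsMorphismNear ℬ 𝒦 j π (f x))
    (hΦ : IsMorphismNear 𝒜 𝒦 (j ∘ f) Φ x) (h : IsLiftNear 𝒜 ℬ π f Φ F x) :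
    ∀ᶠ g in dnhds (𝒜.unit x), ℬ.source (F g) = f (𝒜.source g) := by
  filter_upwards [h.tendsto.eventually hπ.source_map, hΦ.source_map, h.lift] with g h1 h2 h3
  exact hj (by rw [← h1, h3, h2, Function.comp_apply])

theorem target_map (hj : Function.Injective j) (hπ : IsMorphismNear ℬ 𝒦 j π (f x))
    (hΦ : IsMorphismNear 𝒜 𝒦 (j ∘ f) Φ x) (h : IsLiftNear 𝒜 ℬ π f Φ F x) :
    ∀ᶠ g in dnhds (𝒜.unit x), ℬ.target (F g) = f (𝒜.target g) := by
  filter_upwards [h.tendsto.eventually hπ.target_map, hΦ.target_map, h.lift] with g h1 h2 h3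
  exact hj (by rw [← h1, h3, h2, Function.comp_apply])

/-- Two lifts agree near the unit: join an arrow to a unit inside its source fiber. -/
theorem eventuallyEq (h𝒜 : 𝒜.IsLie) (hℬ : ℬ.IsLie) (hfib : ∀ k, IsTotDisconnected (π ⁻¹' {k}))
    (hj : Function.Injective j) (hπ : IsMorphismNear ℬ 𝒦 j π (f x))
    (hΦ : IsMorphismNear 𝒜 𝒦 (j ∘ f) Φ x) (h : IsLiftNear 𝒜 ℬ π f Φ F x)
    (h' : IsLiftNear 𝒜 ℬ π f Φ F' x) : F =ᶠ[dnhds (𝒜.unit x)] F' := by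
  obtain ⟨Ω, hΩ, key⟩ := exists_nhds_forall_path_eq hℬ hfib hj hπ
  have hO := ((h.smooth.eventually.and h'.smooth.eventually).and
    ((h.tendsto.eventually hΩ).and (h'.tendsto.eventually hΩ))).and
    ((h.lift.and h'.lift).and (h.source_map hj hπ hΦ))
  filter_upwards [eventually_exists_path h𝒜 hO, (𝒜.tendsto_source x).eventually h.map_unit,
    (𝒜.tendsto_source x).eventually h'.map_unit] with g ⟨c, hc, hcO, hcs, ⟨z₀, hz₀⟩, z₁, hz₁⟩ h1 h2
  have := key (F ∘ c) (F' ∘ c) (SmoothNear.isPlot_comp hc fun z => (hcO z).1.1.1)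
    (SmoothNear.isPlot_comp hc fun z => (hcO z).1.1.2) (fun z => (hcO z).1.2.1)
    (fun z => (hcO z).1.2.2) (fun z => (hcO z).2.1.1.trans (hcO z).2.1.2.symm)
    (fun z w => by
      rw [Function.comp_apply, Function.comp_apply, (hcO z).2.2, (hcO w).2.2, hcs, hcs])
    ⟨z₀, by rw [Function.comp_apply, Function.comp_apply, hz₀, h1, h2]⟩ z₁
  rwa [Function.comp_apply, Function.comp_apply, hz₁] at this

/-- A lift of a morphism is compatible with products near the unit: for composable `g` and `h`,
`F (c h)` and `F c * F h` are two lifts of the same path when `c` moves from a unit to `g` in the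
source fiber of `g`. -/
theorem map_mul (h𝒜 : 𝒜.IsLie) (hℬ : ℬ.IsLie) (hfib : ∀ k, IsTotDisconnected (π ⁻¹' {k}))
    (hj : Function.Injective j) (hπ : IsMorphismNear ℬ 𝒦 j π (f x))
    (hΦ : IsMorphismNear 𝒜 𝒦 (j ∘ f) Φ x) (hF : IsLiftNear 𝒜 ℬ π f Φ F x) :
    ∀ᶠ p in dnhds (𝒜.unit x) ×ˢ dnhds (𝒜.unit x), 𝒜.source p.1 = 𝒜.target p.2 →
      ∃ k, IsProd 𝒜.mul p.1 p.2 k ∧ IsProd ℬ.mul (F p.1) (F p.2) (F k) := by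
  obtain ⟨Ω, hΩ, key⟩ := exists_nhds_forall_path_eq hℬ hfib hj hπ
  have hsrc := hF.source_map hj hπ hΦ
  have htgt := hF.target_map hj hπ hΦ
  have hO := hF.smooth.eventually.and ((hF.tendsto.eventually hΩ).and (hF.lift.and hsrc))
  have hcomp : ∀ᶠ p in dnhds (𝒜.unit x) ×ˢ dnhds (𝒜.unit x), 𝒜.source p.1 = 𝒜.target p.2 →
      ℬ.source (F p.1) = ℬ.target (F p.2) := by
    filter_upwards [tendsto_fst.eventually hsrc, tendsto_snd.eventually htgt] with p h1 h2 h3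
    rw [h1, h2, h3]
  have hgood := (((eventually_exists_mul h𝒜 hO).and
    (eventually_exists_isProd h𝒜 hF.smooth hF.apply_unit hcomp hΩ)).and
    (hΦ.map_mul.and ((hF.tendsto.prodMap hF.tendsto).eventually hπ.map_mul))).and
    ((tendsto_fst.eventually hO).and ((tendsto_snd.eventually hO).and hcomp))
  obtain ⟨O, hO', hgood⟩ := mem_prod_self_iff.1 hgood
  filter_upwards [tendsto_fst.eventually (eventually_exists_path h𝒜 hO'),
    tendsto_snd.eventually hO', tendsto_snd.eventually htgt, tendsto_snd.eventually
      ((𝒜.tendsto_target x).eventually hF.map_unit)] with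
    ⟨g, h⟩ ⟨c, hc, hcO, hcs, ⟨z₀, hz₀⟩, z₁, hz₁⟩ hh htF huF hgh
  simp only at hcs hz₀ hz₁ htF huF hgh hh
  have good := fun z => hgood (Set.mk_mem_prod (hcO z) hh)
  simp only [Set.mem_ofPred_eq, Prod.map_apply] at good
  have hch : ∀ z, 𝒜.source (c z) = 𝒜.target h := fun z => (hcs z).trans hgh
  choose k hk hkp using fun z => (good z).1.1.1 (hch z)
  choose l hlΩ hlp using fun z => (good z).1.1.2 (hch z)
  have hkplot : IsPlot k := 𝒜.isPlot_op hc isPlot_const hkp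
  have hFc : IsPlot (F ∘ c) := SmoothNear.isPlot_comp hc fun z => (good z).2.1.1
  have hlplot : IsPlot l := ℬ.isPlot_op hFc isPlot_const hlp
  have heq : ∀ z, F (k z) = l z := by
    refine key (F ∘ k) l (SmoothNear.isPlot_comp hkplot fun z => (hk z).1) hlplot
      (fun z => (hk z).2.1) hlΩ (fun z => ?_) (fun z w => ?_) ⟨z₀, ?_⟩
    · obtain ⟨k', hk', hk''⟩ := (good z).1.2.1 (hch z)
      obtain ⟨l', hl', hl''⟩ := (good z).1.2.2 ((good z).2.2.2 (hch z))
      obtain rfl := hk'.unique (hkp z)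
      obtain rfl := hl'.unique (hlp z)
      rw [(good z).2.1.2.2.1, (good z).2.2.1.2.2.1] at hl''
      rw [Function.comp_apply, (hk z).2.2.1]
      exact hk''.unique hl''
    · rw [Function.comp_apply, Function.comp_apply, (hk z).2.2.2, (hk w).2.2.2,
        𝒜.source_mul _ _ _ (hkp z), 𝒜.source_mul _ _ _ (hkp w)]
    · have h1 := hkp z₀
      have h2 := hlp z₀
      rw [hz₀, hgh] at h1 h2
      rw [huF, ← htF] at h2
      rw [Function.comp_apply, 𝒜.unit_mul _ _ h1, ℬ.unit_mul _ _ h2]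
  have h1 := hkp z₁
  have h2 := hlp z₁
  rw [hz₁] at h1 h2
  rw [← heq z₁] at h2
  exact ⟨_, h1, h2⟩

end IsLiftNear

/-- Local lifts exist. A lift `ψ` of the map `Φ` is provided by the local subduction `π`; then
`g ↦ ψ g * (ψ (u (s g)))⁻¹` is a lift that takes units to units. -/
theorem exists_isLiftNear [DiffeologicalSpace K] [DiffeologicalSpace Z] {𝒜 : LocalQUEDGroupoid A X} {ℬ : LocalQUEDGroupoid B Y}
    {𝒦 : LocalQUEDGroupoid K Z} {π : B → K} {j : Y → Z} {f : X → Y} {Φ : A → K} {x : X}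
    (h𝒜 : 𝒜.IsLie) (hℬ : ℬ.IsLie) (hsub : IsLocalSubduction π) (hj : Function.Injective j)
    (hπ : IsMorphismNear ℬ 𝒦 j π (f x)) (hΦ : IsMorphismNear 𝒜 𝒦 (j ∘ f) Φ x) :
    ∃ F : A → B, IsLiftNear 𝒜 ℬ π f Φ F x := by
  classical
  obtain ⟨n, φ, ξ, hφ, hφ0, hξφ, hξ, hφξ⟩ := h𝒜.1.exists_chart (𝒜.unit x)
  replace hξ : SmoothNear ξ (𝒜.unit x) := hφ0 ▸ hξ 0
  replace hφξ : ∀ᶠ g in dnhds (𝒜.unit x), φ (ξ g) = g := hφ0 ▸ hφξ 0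
  have hξ0 : ξ (𝒜.unit x) = 0 := by rw [← hφ0, hξφ]
  obtain ⟨W, hW, hxW, hWs⟩ := hΦ.smooth
  obtain ⟨V, hVU, ha, ψ, hV, hψ, hψ0, hψp⟩ := hsub.lift n (φ ⁻¹' W)
    (isOpen_iff_preimages_plots.1 hW n φ hφ) (fun v => Φ (φ v))
    (fun m q hq => dSmooth_restrict_iff.1 hWs m _ (hφ.dSmooth m _ hq) fun a => (q a).2)
    ⟨0, by rw [Set.mem_preimage, hφ0]; exact hxW⟩ (ℬ.unit (f x))
    (by simp only [hφ0, hΦ.apply_unit, hπ.apply_unit, Function.comp_apply])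
  set ψ₁ : EuclideanSpace ℝ (Fin n) → B := fun v => if h : v ∈ V then ψ ⟨v, h⟩ else ℬ.unit (f x)
    with hψ₁
  have hψ₁V : ∀ v (h : v ∈ V), ψ₁ v = ψ ⟨v, h⟩ := fun v h => by simp [hψ₁, h]
  have hψ₁s : SmoothNear ψ₁ 0 := by
    refine ⟨V, hV, ha, ?_⟩
    have : (fun v : V => ψ₁ v) = ψ := funext fun v => hψ₁V v v.2
    rwa [this]
  set Ψ : A → B := fun g => ψ₁ (ξ g) with hΨ
  have hΨs : SmoothNear Ψ (𝒜.unit x) := SmoothNear.comp_of_eq hψ₁s hξ hξ0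
  have hΨ0 : Ψ (𝒜.unit x) = ℬ.unit (f x) := by
    simp only [hΨ, hξ0]
    rw [hψ₁V 0 ha]
    exact hψ0
  have hΨt : Tendsto Ψ (dnhds (𝒜.unit x)) (dnhds (ℬ.unit (f x))) := hΨs.tendsto_of_eq hΨ0
  have hπΨ : ∀ᶠ g in dnhds (𝒜.unit x), π (Ψ g) = Φ g := by
    filter_upwards [hφξ, (hξ.tendsto_of_eq hξ0).eventually (hV.mem_nhds ha)] with g h1 h2
    simp only [hΨ]
    rw [hψ₁V _ h2, hψp ⟨_, h2⟩]
    simp only [h1]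
  have hsΨ : ∀ᶠ g in dnhds (𝒜.unit x), ℬ.source (Ψ g) = f (𝒜.source g) := by
    filter_upwards [hΨt.eventually hπ.source_map, hΦ.source_map, hπΨ] with g h1 h2 h3
    exact hj (by rw [← h1, h3, h2, Function.comp_apply])
  have htΨ : ∀ᶠ g in dnhds (𝒜.unit x), ℬ.target (Ψ g) = f (𝒜.target g) := by
    filter_upwards [hΨt.eventually hπ.target_map, hΦ.target_map, hπΨ] with g h1 h2 h3
    exact hj (by rw [← h1, h3, h2, Function.comp_apply])
  obtain ⟨ι, hι, hι0, -, hr⟩ := exists_inv hℬ (f x)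
  have hιt : Tendsto ι (dnhds (ℬ.unit (f x))) (dnhds (ℬ.unit (f x))) := hι.tendsto_of_eq hι0
  set β : A → B := fun g => Ψ (𝒜.unit (𝒜.source g)) with hβ
  have hust := 𝒜.tendsto_unit_source x
  have hus0 : 𝒜.unit (𝒜.source (𝒜.unit x)) = 𝒜.unit x := by rw [𝒜.source_unit]
  have hβs : SmoothNear β (𝒜.unit x) :=
    SmoothNear.comp_of_eq hΨs ((𝒜.unit_smooth.comp 𝒜.source_smooth).smoothNear _) hus0
  have hβ0 : β (𝒜.unit x) = ℬ.unit (f x) := by simp only [hβ, hus0, hΨ0]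
  have hβt : Tendsto β (dnhds (𝒜.unit x)) (dnhds (ℬ.unit (f x))) := hβs.tendsto_of_eq hβ0
  have hιβ : SmoothNear (fun g => ι (β g)) (𝒜.unit x) := SmoothNear.comp_of_eq hι hβs hβ0
  have hcomp : ∀ᶠ g in dnhds (𝒜.unit x), ℬ.source (Ψ g) = ℬ.target (ι (β g)) := by
    filter_upwards [hsΨ, hust.eventually hsΨ, hβt.eventually hr] with g h1 h2 h3
    rw [← h3.source_eq_target, h1, h2, 𝒜.source_unit]
  obtain ⟨hprod, hops⟩ := ℬ.smoothNear_op hΨs hιβ hcomp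
    ⟨_, by rw [hΨ0, hβ0, hι0]; exact ℬ.isProd_unit_unit _⟩
  have htβ : ∀ᶠ g in dnhds (𝒜.unit x), ℬ.target (β g) = f (𝒜.source g) := by
    filter_upwards [hust.eventually htΨ] with g h1
    simp only [hβ, h1, 𝒜.target_unit]
  refine ⟨fun g => ℬ.op (Ψ g) (ι (β g)), hops, ?_, ?_⟩
  · have hutβ : ∀ᶠ g in dnhds (𝒜.unit x),
        π (ℬ.unit (ℬ.target (β g))) = 𝒦.unit (j (ℬ.target (β g))) :=
      (hβt.eventually ((ℬ.tendsto_target (f x)).eventually hπ.map_unit))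
    filter_upwards [hprod, hcomp, hβt.eventually hr, htβ, hutβ, hπΨ, hust.eventually hπΨ,
      (𝒜.tendsto_source x).eventually hΦ.map_unit, hΦ.source_map,
      (hΨt.prodMk (hιt.comp hβt)).eventually hπ.map_mul,
      (hβt.prodMk (hιt.comp hβt)).eventually hπ.map_mul]
      with g h1 h2 h3 h4 h5 h6 h7 h8 h9 h10 h11
    obtain ⟨k, hk, hk'⟩ := h10 h2
    obtain ⟨l, hl, hl'⟩ := h11 h3.source_eq_target
    simp only [Function.comp_apply] at hk hk' hl hl'
    obtain rfl := hk.unique h1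
    obtain rfl := hl.unique h3
    -- `π` takes the correction factor to a unit.
    have e1 : π (β g) = 𝒦.unit (j (f (𝒜.source g))) := h7.trans h8
    have e2 : 𝒦.target (π (ι (β g))) = j (f (𝒜.source g)) := by
      rw [← hl'.source_eq_target, e1, 𝒦.source_unit]
    have e3 : π (ι (β g)) = 𝒦.unit (j (f (𝒜.source g))) := by
      rw [e1, ← e2] at hl'
      rw [← 𝒦.unit_mul _ _ hl', h5, h4]
    rw [h6, e3, ← Function.comp_apply (f := j), ← h9] at hk'
    exact 𝒦.mul_unit _ _ hk'
  · have ht := 𝒜.tendsto_unit x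
    filter_upwards [ht.eventually (hβt.eventually hr), ht.eventually htβ] with x' h1 h2
    have e1 : Ψ (𝒜.unit x') = β (𝒜.unit x') := by simp only [hβ, 𝒜.source_unit]
    rw [e1, ℬ.op_eq h1, h2, 𝒜.source_unit]

end Lifts

end LocalQUEDGroupoid

/-! ### Gluing local lifts along the units -/

namespace LocalQUEDGroupoid

section Gluing

variable {A X B Y K Z : Type u} [DiffeologicalSpace A] [DiffeologicalSpace X]
  [DiffeologicalSpace B] [DiffeologicalSpace Y] [DiffeologicalSpace K] [DiffeologicalSpace Z]
  {𝒜 : LocalQUEDGroupoid A X} {ℬ : LocalQUEDGroupoid B Y} {𝒦 : LocalQUEDGroupoid K Z}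
  {π : B → K} {j : Y → Z} {f : X → Y} {Φ : A → K}

/-- Local lifts along the units glue: over a locally finite closed cover of the objects, select for
each arrow one of the local lifts that belong to its source. -/
theorem exists_forall_isLiftNear (h𝒜 : 𝒜.IsLie) (hℬ : ℬ.IsLie) (hsub : IsLocalSubduction π)
    (hfib : ∀ k, IsTotDisconnected (π ⁻¹' {k})) (hj : Function.Injective j)
    (hπ : ∀ y, IsMorphismNear ℬ 𝒦 j π y) (hΦ : ∀ x, IsMorphismNear 𝒜 𝒦 (j ∘ f) Φ x) :
    ∃ F : A → B, ∀ x, IsLiftNear 𝒜 ℬ π f Φ F x := by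
  choose F hF using fun x => exists_isLiftNear h𝒜 hℬ hsub hj (hπ (f x)) (hΦ x)
  obtain ⟨C, hC, hCF, hCfin⟩ := h𝒜.2.exists_closed_cover
    (W := fun i => {x | IsLiftNear 𝒜 ℬ π f Φ (F i) x}) fun i => (hF i).eventually
  choose i hi using hC
  refine ⟨fun g => F (i (𝒜.source g)) g, fun x => ?_⟩
  have hx : IsLiftNear 𝒜 ℬ π f Φ (F (i x)) x := hCF _ (hi x)
  refine hx.congr ?_
  have h1 : ∀ᶠ g in dnhds (𝒜.unit x), ∀ i' ∈ {i | x ∈ C i}, F (i x) g = F i' g :=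
    (eventually_all_finite (hCfin x).1).2 fun i' hi' =>
      hx.eventuallyEq h𝒜 hℬ hfib hj (hπ (f x)) (hΦ x) (hCF i' hi')
  filter_upwards [h1, (𝒜.tendsto_source x).eventually (hCfin x).2] with g h2 h3
  exact h2 _ (h3 _ (hi _))

/-- A map that lifts a morphism near every unit is a morphism on some neighborhood of the units.
Again by a locally finite closed cover of the objects, this neighborhood can be chosen so small
that any two composable arrows in it are close to the same unit. -/
theorem exists_isMorphismOn_of_isLiftNear (h𝒜 : 𝒜.IsLie) (hℬ : ℬ.IsLie)
    (hfib : ∀ k, IsTotDisconnected (π ⁻¹' {k})) (hj : Function.Injective j)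
    (hπ : ∀ y, IsMorphismNear ℬ 𝒦 j π y) (hΦ : ∀ x, IsMorphismNear 𝒜 𝒦 (j ∘ f) Φ x)
    {F : A → B} (hF : ∀ x, IsLiftNear 𝒜 ℬ π f Φ F x) :
    ∃ U : Set A, DOpen U ∧ Set.range 𝒜.unit ⊆ U ∧ IsMorphismOn 𝒜 ℬ f F U := by
  choose O hO hOmul using fun x => mem_prod_self_iff.1
    ((hF x).map_mul h𝒜 hℬ hfib hj (hπ (f x)) (hΦ x))
  obtain ⟨C, hC, hCO, hCfin⟩ := h𝒜.2.exists_closed_cover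
    (W := fun i => {x | O i ∈ dnhds (𝒜.unit x)}) fun i =>
      (𝒜.tendsto_unit i).eventually (eventually_eventually_dnhds.2 (hO i))
  set Q : A → Prop := fun g => SmoothNear F g ∧ ℬ.source (F g) = f (𝒜.source g) ∧
    ℬ.target (F g) = f (𝒜.target g) ∧ ∀ i, 𝒜.source g ∈ C i ∨ 𝒜.target g ∈ C i → g ∈ O i
  have hU : ∀ g ∈ {g | ∀ᶠ g' in dnhds g, Q g'}, Q g := fun g hg => self_of_dnhds (p := Q) hg
  refine ⟨{g | ∀ᶠ g' in dnhds g, Q g'}, dOpen_setOf_eventually Q, ?_, ?_⟩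
  · rintro _ ⟨x, rfl⟩
    have h1 : ∀ᶠ g in dnhds (𝒜.unit x), ∀ i ∈ {i | x ∈ C i}, g ∈ O i :=
      (eventually_all_finite (hCfin x).1).2 fun i hi => hCO i hi
    change ∀ᶠ g in dnhds (𝒜.unit x), Q g
    filter_upwards [(hF x).smooth.eventually, (hF x).source_map hj (hπ (f x)) (hΦ x),
      (hF x).target_map hj (hπ (f x)) (hΦ x), h1,
      (𝒜.tendsto_source x).eventually (hCfin x).2,
      (𝒜.tendsto_target x).eventually (hCfin x).2] with g h2 h3 h4 h5 h6 h7
    exact ⟨h2, h3, h4, fun i hi => h5 i (hi.elim (h6 i) (h7 i))⟩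
  · refine ⟨dSmooth_restrict_of_smoothNear fun g hg => (hU g hg).1,
      fun x => ⟨f x, (hF x).apply_unit.symm⟩, fun g hg => (hU g hg).2.1,
      fun g hg => (hU g hg).2.2.1, fun g hg h hh k _ l hk hl => ?_⟩
    obtain ⟨i, hi⟩ := hC (𝒜.source g)
    have hgO : g ∈ O i := (hU g hg).2.2.2 i (Or.inl hi)
    have hhO : h ∈ O i := (hU h hh).2.2.2 i (Or.inr (hk.source_eq_target ▸ hi))
    obtain ⟨k', hk', hl'⟩ := hOmul i (Set.mk_mem_prod hgO hhO) hk.source_eq_target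
    obtain rfl := hk'.unique hk
    exact hl'.unique hl

end Gluing

/-! ### Germs of morphisms and charts -/

section GermsOfMorphisms

variable {G M H N K Z : Type u} [DiffeologicalSpace G] [DiffeologicalSpace M]
  [DiffeologicalSpace H] [DiffeologicalSpace N] [DiffeologicalSpace K] [DiffeologicalSpace Z]
  {𝒢 : LocalQUEDGroupoid G M} {ℋ : LocalQUEDGroupoid H N} {𝒦 : LocalQUEDGroupoid K Z}

theorem eventually_nhdsUnits {p : G → Prop} :
    (∀ᶠ g in 𝒢.nhdsUnits, p g) ↔ ∀ x, ∀ᶠ g in dnhds (𝒢.unit x), p g := by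
  let _ : TopologicalSpace G := DiffeologicalSpace.dTopology
  change (∀ᶠ g in 𝓝ˢ (Set.range 𝒢.unit), p g) ↔ _
  rw [eventually_nhdsSet_iff_forall, Set.forall_mem_range]
  rfl

theorem Hom.germComp_eq_coe {ψ : Hom ℋ 𝒦} {φ : Hom 𝒢 ℋ} {b : H → K} {a : G → H}
    (hb : ψ.germ = (b : Germ ℋ.nhdsUnits K)) (ha : φ.germ = (a : Germ 𝒢.nhdsUnits H)) :
    ψ.germComp φ = ((b ∘ a : G → K) : Germ 𝒢.nhdsUnits K) := by
  obtain ⟨_, _, _, _⟩ := ψ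
  obtain ⟨_, _, _, _⟩ := φ
  subst hb ha
  rfl

theorem LieChart.isMorphismNear (c : 𝒢.LieChart) (x : c.objects) :
    IsMorphismNear c.groupoid 𝒢 Subtype.val c.π x := by
  obtain ⟨P, U, hP, hU, hunit, hmor⟩ := c.hom.exists_rep
  rw [c.hom_base] at hmor
  rw [c.hom_germ, Germ.coe_eq] at hP
  exact (hmor.isMorphismNear c.isLie hU hunit x).congr c.isLie (eventually_nhdsUnits.1 hP x)

end GermsOfMorphisms

end LocalQUEDGroupoid

end SingLie

open Diffeology Filter LocalQUEDGroupoid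

theorem mainTheorem5 {G M H N : Type u} [DiffeologicalSpace G] [DiffeologicalSpace M]
    [DiffeologicalSpace H] [DiffeologicalSpace N]
    (𝒢 : LocalQUEDGroupoid G M) (ℋ : LocalQUEDGroupoid H N)
    (h𝒢 : 𝒢.IsSingularLie) (hℋ : ℋ.IsSingularLie)
    (F : 𝒢.Hom ℋ) (c𝒢 : 𝒢.LieChart) (cℋ : ℋ.LieChart)
    (hc𝒢 : c𝒢.IsWide) (hcℋ : cℋ.IsWide) :
    ∃! F' : c𝒢.groupoid.Hom cℋ.groupoid, cℋ.hom.germComp F' = F.germComp c𝒢.hom := by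
  obtain ⟨F₀, U₀, hF₀, hU₀, hunit₀, hmor₀⟩ := F.exists_rep
  -- Since `cℋ` is wide, the base map of `F` restricts to the objects of the charts.
  set f : c𝒢.objects → cℋ.objects := fun x => ⟨F.base x, by rw [hcℋ]; trivial⟩
  have hfs : DSmooth f := fun n p hp => F.base_smooth n _ hp
  have hΦ : ∀ x, IsMorphismNear c𝒢.groupoid ℋ (Subtype.val ∘ f) (F₀ ∘ c𝒢.π) x := fun x =>
    hmor₀.comp_isMorphismNear c𝒢.isLie hU₀ hunit₀ (c𝒢.isMorphismNear x)
  have hπ := cℋ.isMorphismNear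
  have hfib := cℋ.quasiEtale.fibers
  have hj : Function.Injective (Subtype.val : cℋ.objects → N) := Subtype.val_injective
  have hcomp : F.germComp c𝒢.hom = ((F₀ ∘ c𝒢.π : _ → H) : Germ c𝒢.groupoid.nhdsUnits H) :=
    Hom.germComp_eq_coe hF₀.symm c𝒢.hom_germ
  obtain ⟨F₁, hF₁⟩ := exists_forall_isLiftNear c𝒢.isLie cℋ.isLie
    cℋ.quasiEtale.localSubduction hfib hj hπ hΦ
  obtain ⟨U₁, hU₁, hunit₁, hmor₁⟩ :=
    exists_isMorphismOn_of_isLiftNear c𝒢.isLie cℋ.isLie hfib hj hπ hΦ hF₁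
  refine ⟨⟨f, hfs, F₁, F₁, U₁, rfl, hU₁, hunit₁, hmor₁⟩, ?_, fun F' hF' => ?_⟩
  · change cℋ.hom.germComp _ = _
    rw [hcomp, Hom.germComp_eq_coe cℋ.hom_germ rfl, Germ.coe_eq]
    exact eventually_nhdsUnits.2 fun x => (hF₁ x).lift
  · obtain ⟨F₂, U₂, hF₂, hU₂, hunit₂, hmor₂⟩ := F'.exists_rep
    change cℋ.hom.germComp F' = _ at hF'
    rw [hcomp, Hom.germComp_eq_coe cℋ.hom_germ hF₂.symm, Germ.coe_eq] at hF'
    have hlift := eventually_nhdsUnits.1 hF'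
    have hbase : F'.base = f := funext fun x => hj <| by
      have h1 : cℋ.π (F₂ (c𝒢.groupoid.unit x)) = (F₀ ∘ c𝒢.π) (c𝒢.groupoid.unit x) :=
        self_of_dnhds (p := fun g => cℋ.π (F₂ g) = (F₀ ∘ c𝒢.π) g) (hlift x)
      rw [hmor₂.apply_unit hunit₂, (hπ _).apply_unit, (hΦ x).apply_unit] at h1
      simpa only [ℋ.source_unit, Function.comp_apply] using congrArg ℋ.source h1
    have hF₂' : ∀ x, IsLiftNear c𝒢.groupoid cℋ.groupoid cℋ.π f (F₀ ∘ c𝒢.π) F₂ x := fun x =>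
      ⟨⟨U₂, hU₂, hunit₂ ⟨x, rfl⟩, hmor₂.smooth⟩, hlift x,
        Eventually.of_forall fun x' => hbase ▸ hmor₂.apply_unit hunit₂ x'⟩
    refine Hom.ext hbase ?_
    rw [← hF₂, Germ.coe_eq]
    exact eventually_nhdsUnits.2 fun x =>
      (hF₂' x).eventuallyEq c𝒢.isLie cℋ.isLie hfib hj (hπ _) (hΦ x) (hF₁ x)
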